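/- Consider the Airy curve $A(u,v)=\tfrac12 v^2-u=0$ with the parametrization $u(p)=\tfrac12p^2$, $v(p)=p$. Its Eynard–Orantin differentials $W_{g,n}=\mathcal W_{g,n}(p_1,\dots,p_n)\,dp_1\cdots dp_n$ ($g\ge 0$, $n\ge 1$) are defined by $\mathcal W_{0,1}=0$, $\mathcal W_{0,2}(p_1,p_2)=(p_1-p_2)^{-2}$ and, for $2g+n>1$, by the recursion $$\mathcal W_{g,n+1}(z_0,z_1,\dots,z_n)=\frac12\operatorname*{Res}_{z=0}\frac{1}{z(z_0^2-z^2)}\Bigl(\mathcal W_{g-1,n+2}(z,-z,z_{[n]})+\sum_{\substack{g_1+g_2=g\\ A_1\sqcup A_2=[n]}}\mathcal W_{g_1,|A_1|+1}(z,z_{A_1})\,\mathcal W_{g_2,|A_2|+1}(-z,z_{A_2})\Bigr),$$ where $[n]=\{1,\dots,n\}$, $z_{A}=(z_i)_{i\in A}$ in increasing order of $i$, $\mathcal W_{-1,n+2}=0$, and summands with a factor $\mathcal W_{0,1}$ are zero. Let $U\subset\mathbb C$ be open, let $p=p(u)$ be a holomorphic branch over $U$ of the parameter, i.e. $\tfrac12p(u)^2=u$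 (so $p=\pm\sqrt{2u}$), and let $\log\frac{du}{dp}$ be a holomorphic branch over $U$ of the logarithm of $\frac{du}{dp}$ at $p=p(u)$. As functions of $u\in U$ put $$S_0=\int^p v\,du,\qquad S_1=-\tfrac12\log\frac{du}{dp},\qquad S_n=\sum_{\substack{g\ge 0,\ k\ge 1\\ 2g-1+k=n}}\frac{(-1)^k}{k!}\int_\infty^p\!\!\cdots\int_\infty^p\mathcal W_{g,k}(p_1',\dots,p_k')\,dp_1'\cdots dp_k'\quad(n\ge2),$$ where $\int^pv\,du$ is any primitive of $v\,du$ on the curve and the other integrals are taken along the ray from $\infty$ to $p$. Let $$Z=\exp\sum_{n\ge0}\hbar^{n-1}S_n=e^{S_0/\hbar}\,e^{S_1}\exp\Bigl(\sum_{n\ge2}\hbar^{n-1}S_n\Bigr),$$ understood as $e^{S_0/\hbar}$ times a formal power series in $\hbar$ whose coefficients are functions of $u$; on such expressions $\partial_u$ acts by $\partial_u\bigl(e^{S_0/\hbar}a\bigr)=e^{S_0/\hbar}\bigl(\hbar^{-1}(\partial_uS_0)\,a+\partial_u a\bigr)$, with $\partial_u a$ taken coefficientwise. Then everything is well defined: for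 nonzero $z_0,\dots,z_n$ the residues exist, for nonzero endpoints the integrals of the $\mathcal W_{g,k}$ with $2g-2+k>0$ converge absolutely, and the functions $S_n$ and the coefficients of the power series factor of $Z$ are holomorphic on $U$. Moreover, on $U$, $$\hat A Z=0,\qquad \hat A=\tfrac12\hat v^2-\hat u,\quad \hat u=u\,\cdot,\quad \hat v=\hbar\,\partial_u,$$ that is, $\bigl(\tfrac{\hbar^2}{2}\partial_u^2-u\bigr)Z=0$. -/

import Mathlib

open scoped Topology

noncomputable section

namespace Airy

/-! ### The Airy curve `v ^ 2 / 2 - u = 0` and its parametrization -/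

/-- The coordinate `u(p) = p ^ 2 / 2` on the Airy curve. -/
def curveU (p : ℂ) : ℂ := p ^ 2 / 2

/-- The coordinate `v(p) = p` on the Airy curve. -/
def curveV (p : ℂ) : ℂ := p

/-! ### Residues -/

/-- `f` has residue `a` at `c`: the integrals of `f` over small circles around `c`, divided by
`2 π i`, converge to `a`. For `f` holomorphic on a punctured neighbourhood of `c` these integrals
do not depend on the (small) radius, and this is the usual residue. -/
def HasResidue (f : ℂ → ℂ) (c a : ℂ) : Prop :=
  Filter.Tendsto (fun r : ℝ => (2 * Real.pi * Complex.I)⁻¹ * ∮ z in C(c, r), f z)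
    (𝓝[>] 0) (𝓝 a)

/-- The residue of `f` at `c`. -/
def residue (f : ℂ → ℂ) (c : ℂ) : ℂ :=
  (𝓝[>] (0 : ℝ)).limUnder fun r : ℝ => (2 * Real.pi * Complex.I)⁻¹ * ∮ z in C(c, r), f z

theorem HasResidue.residue_eq {f : ℂ → ℂ} {c a : ℂ} (h : HasResidue f c a) : residue f c = a :=
  Filter.Tendsto.limUnder_eq h

/-! ### The Eynard-Orantin differentials -/

/-- For `A = {i₁ < ⋯ < iₖ}`, the tuple `(z, z_{i₁}, …, z_{iₖ})`. -/
def consSub {n : ℕ} (z : ℂ) (zs : Fin n → ℂ) (A : Finset (Fin n)) : Fin (A.card + 1) → ℂ :=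
  Matrix.vecCons z fun i => zs (A.orderEmbOfFin rfl i)

/-- The coefficient functions of the Eynard-Orantin differentials of the Airy curve,
`W_{g,n} = W g n (p₁, …, pₙ) dp₁ ⋯ dpₙ`, for `n ≥ 1`. The initial values are `W_{0,1} = 0` and the
Bergman kernel `W_{0,2} = 1 / (p₁ - p₂) ^ 2`; all others come from the residue recursion at the
branch point `p = 0`, with conjugation `p ↦ -p` and the recursion kernel
`1 / (z (p₁ ^ 2 - z ^ 2))` of the Airy curve. The summands with a factor `W_{0,1} = 0` are left
out, since the other factor would be the function being defined; `W_rec` below is the recursion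
with all summands. The value for `n = 0` plays no role. -/
def W (g n : ℕ) (p : Fin n → ℂ) : ℂ :=
  match n, p with
  | 0, _ => 0
  | m + 1, p =>
    if g = 0 ∧ m = 0 then 0
    else if g = 0 ∧ m = 1 then 1 / (p 0 - p (Fin.last m)) ^ 2
    else
      1 / 2 * residue (fun z : ℂ =>
        1 / (z * (p 0 ^ 2 - z ^ 2)) *
          ((if _hg : 0 < g then
              W (g - 1) (m + 2) (Matrix.vecCons z (Matrix.vecCons (-z) (Fin.tail p)))
            else 0) +
            ∑ g₁ : Fin (g + 1), ∑ A : Finset (Fin m),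
              if _h : (0 < (g₁ : ℕ) ∨ 0 < A.card) ∧ (0 < g - (g₁ : ℕ) ∨ 0 < Aᶜ.card) then
                W g₁ (A.card + 1) (consSub z (Fin.tail p) A) *
                  W (g - g₁) (Aᶜ.card + 1) (consSub (-z) (Fin.tail p) Aᶜ)
              else 0)) 0
termination_by 2 * g + n
decreasing_by
  · omega
  · have h1 := g₁.isLt
    have h2 : A.card + Aᶜ.card = m := by
      simp [A.card_add_card_compl]
    omega
  · have h1 := g₁.isLt
    have h2 : A.card + Aᶜ.card = m := by
      simp [A.card_add_card_compl]
    omega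

/-- The expression whose residue at `z = 0` is taken in the recursion for
`W_{g,n+1}(z₀, z₁, …, zₙ)`, with `W_{-1,n+2} = 0`. -/
def recIntegrand (g n : ℕ) (z₀ : ℂ) (zs : Fin n → ℂ) (z : ℂ) : ℂ :=
  1 / (z * (z₀ ^ 2 - z ^ 2)) *
    ((if 0 < g then W (g - 1) (n + 2) (Matrix.vecCons z (Matrix.vecCons (-z) zs)) else 0) +
      ∑ g₁ : Fin (g + 1), ∑ A : Finset (Fin n),
        W g₁ (A.card + 1) (consSub z zs A) * W (g - g₁) (Aᶜ.card + 1) (consSub (-z) zs Aᶜ))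

theorem W_zero_one (p : Fin 1 → ℂ) : W 0 1 p = 0 := by
  rw [W]; simp

theorem W_zero_two (p : Fin 2 → ℂ) : W 0 2 p = 1 / (p 0 - p 1) ^ 2 := by
  rw [W]; simp

theorem W_zero_of_card {k : ℕ} (hk : k = 0) (p : Fin (k + 1) → ℂ) : W 0 (k + 1) p = 0 := by
  subst hk; exact W_zero_one p

/-- The Eynard-Orantin recursion, with all summands. -/
theorem W_rec (g n : ℕ) (h : 1 < 2 * g + n) (z₀ : ℂ) (zs : Fin n → ℂ) :
    W g (n + 1) (Matrix.vecCons z₀ zs) = 1 / 2 * residue (recIntegrand g n z₀ zs) 0 := by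
  rw [W]
  rw [if_neg (by omega), if_neg (by omega)]
  congr 2
  funext z
  unfold recIntegrand
  have ht : Fin.tail (Matrix.vecCons z₀ zs) = zs := by
    funext i; simp [Fin.tail]
  rw [ht, dite_eq_ite]
  congr 2
  refine Finset.sum_congr rfl fun g₁ _ => Finset.sum_congr rfl fun A _ => ?_
  split_ifs with hc
  · rfl
  · rw [not_and_or] at hc
    rcases hc with hc | hc
    · have h0 : (g₁ : ℕ) = 0 := by omega
      rw [h0, W_zero_of_card (by omega), zero_mul]
    · have h0 : g - (g₁ : ℕ) = 0 := by omega
      rw [h0, W_zero_of_card (by omega), mul_zero]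

/-! ### The coefficients of the wave function -/

/-- The set of `t` with all coordinates in `(1, ∞)`. -/
def rays (k : ℕ) : Set (Fin k → ℝ) := Set.univ.pi fun _ => Set.Ioi 1

/-- The iterated integral `∫_∞^{z₁} ⋯ ∫_∞^{zₖ} W_{g,k}(p₁, …, pₖ) dp₁ ⋯ dpₖ`, the `i`-th integral
being taken along the ray `pᵢ = tᵢ zᵢ` with `tᵢ` running from `∞` to `1`. -/
def Xi (g k : ℕ) (z : Fin k → ℂ) : ℂ :=
  (∏ i, -z i) * ∫ t in rays k, W g k fun i => (t i : ℂ) * z i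

/-- The functions `S₀, S₁, S₂, …` in the coordinate `u`, where `p` is a branch of the parameter as
a function of `u`, `F` is a primitive of `v du` on the curve, and `l` is a branch of
`log (du / dp)` as a function of `u`. For `n ≥ 2` the sum is over `g ≥ 0` and `k ≥ 1` with
`2 g - 1 + k = n`. -/
def S (F p l : ℂ → ℂ) : ℕ → ℂ → ℂ
  | 0 => fun u => F (p u)
  | 1 => fun u => -(1 / 2) * l u
  | n + 2 => fun u =>
      ∑ x ∈ Finset.range (n + 4) ×ˢ Finset.Icc 1 (n + 3) with 2 * x.1 + x.2 = n + 3,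
        (-1) ^ x.2 / (x.2.factorial : ℂ) * Xi x.1 x.2 fun _ => p u

/-! ### Formal wave functions

A formal wave function with phase `φ` is an expression `exp (φ / ħ) (a₀ + a₁ ħ + a₂ ħ ^ 2 + ⋯)`,
where `φ, a₀, a₁, …` are functions of `u`. It is given by its amplitude, a power series in `ħ`
whose coefficients are functions of `u`. -/

/-- Formal wave functions with phase `φ`, given by their amplitudes. -/
abbrev WaveFunction (_φ : ℂ → ℂ) : Type := PowerSeries (ℂ → ℂ)

/-- The wave function `exp (∑ ħ ^ (n - 1) S n)`, that is,
`exp (S 0 / ħ) * exp (S 1) * exp (∑_{n ≥ 2} ħ ^ (n - 1) S n)`. The last factor is the substitution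
of a power series in `ħ` without constant term into the exponential series. -/
def expWave (S : ℕ → ℂ → ℂ) : WaveFunction (S 0) :=
  PowerSeries.C (fun u => Complex.exp (S 1 u)) *
    (PowerSeries.exp (ℂ → ℂ)).subst
      (PowerSeries.mk fun m => if m = 0 then 0 else S (m + 1) : PowerSeries (ℂ → ℂ))

/-- The operator `û`, multiplication by `u`. -/
def hatU (φ : ℂ → ℂ) (ψ : WaveFunction φ) : WaveFunction φ :=
  PowerSeries.C (fun u : ℂ => u) * ψ

/-- The operator `v̂ = ħ ∂_u`. By the product rule,
`ħ ∂_u (exp (φ / ħ) a) = exp (φ / ħ) (φ' a + ħ a')`. -/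
def hatV (φ : ℂ → ℂ) (ψ : WaveFunction φ) : WaveFunction φ :=
  PowerSeries.C (deriv φ) * ψ +
    PowerSeries.X * PowerSeries.mk fun m => deriv (PowerSeries.coeff m ψ)

/-- The quantum Airy curve `v̂ ^ 2 / 2 - û`. -/
def hatA (φ : ℂ → ℂ) (ψ : WaveFunction φ) : WaveFunction φ :=
  (1 / 2 : ℂ) • hatV φ (hatV φ ψ) - hatU φ ψ

/-- The formula behind `hatV`, for an honest value `h` of the parameter. -/
theorem hatV_formula {h u : ℂ} (hh : h ≠ 0) {φ a : ℂ → ℂ} (hφ : DifferentiableAt ℂ φ u)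
    (ha : DifferentiableAt ℂ a u) :
    h * deriv (fun x => Complex.exp (φ x / h) * a x) u =
      Complex.exp (φ u / h) * (deriv φ u * a u + h * deriv a u) := by
  have h1 := ((hφ.hasDerivAt.div_const h).cexp.mul ha.hasDerivAt).deriv
  have h2 : deriv (fun x => Complex.exp (φ x / h) * a x) u = _ := h1
  rw [h2]
  field_simp

end Airy

end

noncomputable section

namespace Airy

/-! The recursion is solved by a tau function. Apart from the two initial cases, $\mathcal W_{g,n}$
is a polynomial in the $z_i^{-2}$ whose coefficients are Taylor coefficients at the origin of a
polynomial $F_m$ in $X_0,X_1,\dots$ with $m=2g-2+n$. Inserting a point $z$ means applying the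
constant derivation $\sum_k z^{-2(k+1)}\partial_k$ (`loopPt`). The $F_m$ are the coefficients of
$\log\sum_m Z_m h^m$, where $Z_0=1$ and $\partial_a Z_{m+1}=L_a Z_m$ with the second order operators
$L_a$ = `virasoro a`. This system is integrable because the $L_a$ satisfy the Virasoro relations
(`virasoro_succ_comm`, `virasoro_zero_comm`, `pderiv_virasoro_symm`). Euler's formula then produces
$Z_{m+1}$ (`pderiv_partitionCoeff`): $X_k$ has weight $2k+1$ and $Z_m$ has weight $3m$.

Multiplied by $y^{a+1}$ and summed over $a$, the constraints become the loop equation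
`loopDer_freeEnergy`. With $y=z_0^{-2}$ it is the residue recursion term by term. The kernel paired
with a polynomial $P(z^{-2})$ has residue $yP(y)$, which accounts for the second order and quadratic
terms. Paired with the symmetrized $\mathcal W_{0,2}$ it gives the first order shift, and the
potentials give $\mathcal W_{0,3}$ and $\mathcal W_{1,1}$. The genus grading `hasGenus_freeEnergy`
makes the sum over orders a sum over splittings of the genus. Induction on $2g+n$ gives `W_eq_corr`.

Since $\int_\infty^p z^{-2k-2}dz=-p^{-(2k+1)}/(2k+1)$, the sum defining $S_n$ is Taylor's formula
for $F_{n-1}$ at $X_k=p^{-(2k+1)}/(2k+1)$ (`S_add_two`). Exponentiation and homogeneity turn the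
amplitude into $e^{S_1}\sum_m c_m p^{-3m}\hbar^m$ (`coeff_expWave`). At $p=1$ the constraints
collapse to $6(m+1)c_{m+1}=(3m+\frac12)(3m+\frac52)c_m$ (`airyCoeff_succ`). As $dp/du=1/p$, this is
exactly the vanishing of the coefficients of $\hat AZ$. -/

open MvPolynomial

/-! ### The Virasoro operators and the commutators of their first order parts. -/

/-- The derivation of the polynomial ring that maps the variable `X k` to the constant `c k`. -/
def constDer (c : ℕ → ℂ) : Derivation ℂ (MvPolynomial ℕ ℂ) (MvPolynomial ℕ ℂ) :=
  mkDerivation ℂ fun k => C (c k)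

/-- The derivation of the polynomial ring that maps `X k` to `(2 j + 1) X j` with `j = k + 1 - a`,
and to `0` if `k + 1 < a`. For `a = 1` it is the Euler derivation of the weights `2 k + 1`. -/
def shiftDer (a : ℕ) : Derivation ℂ (MvPolynomial ℕ ℂ) (MvPolynomial ℕ ℂ) :=
  mkDerivation ℂ fun k => if a ≤ k + 1 then (2 * ((k + 1 - a : ℕ) : ℂ) + 1) • X (k + 1 - a) else 0

/-- The second order part of the Virasoro operators. -/
def secondOrder (a : ℕ) : MvPolynomial ℕ ℂ →ₗ[ℂ] MvPolynomial ℕ ℂ :=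
  (1 / 2 : ℂ) • ∑ i ∈ Finset.range (a - 1),
    ((pderiv i).toLinearMap ∘ₗ (pderiv (a - 2 - i)).toLinearMap)

/-- The part of order zero of the Virasoro operators. -/
def potential (a : ℕ) : MvPolynomial ℕ ℂ :=
  if a = 0 then (1 / 2 : ℂ) • X 0 ^ 2 else if a = 1 then C (1 / 8) else 0

/-- The Virasoro operators. -/
def virasoro (a : ℕ) : MvPolynomial ℕ ℂ →ₗ[ℂ] MvPolynomial ℕ ℂ :=
  secondOrder a + (shiftDer a).toLinearMap + LinearMap.mulLeft ℂ (potential a)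

theorem virasoro_apply (a : ℕ) (f : MvPolynomial ℕ ℂ) :
    virasoro a f = secondOrder a f + shiftDer a f + potential a * f := rfl

theorem secondOrder_apply (a : ℕ) (f : MvPolynomial ℕ ℂ) :
    secondOrder a f =
      (1 / 2 : ℂ) • ∑ i ∈ Finset.range (a - 1), pderiv i (pderiv (a - 2 - i) f) := by
  simp [secondOrder, LinearMap.sum_apply]

@[simp]
theorem constDer_X (c : ℕ → ℂ) (k : ℕ) : constDer c (X k) = C (c k) := mkDerivation_X _ _ _

theorem shiftDer_X (a k : ℕ) : shiftDer a (X k) =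
    if a ≤ k + 1 then (2 * ((k + 1 - a : ℕ) : ℂ) + 1) • X (k + 1 - a) else 0 :=
  mkDerivation_X _ _ _

theorem pderiv_eq_constDer (i : ℕ) :
    (pderiv i : Derivation ℂ (MvPolynomial ℕ ℂ) (MvPolynomial ℕ ℂ)) = constDer (Pi.single i 1) := by
  refine derivation_ext fun k => ?_
  rw [pderiv_X, constDer_X]
  by_cases h : i = k
  · subst h; simp
  · rw [Pi.single_eq_of_ne (Ne.symm h)]; simp [Ne.symm h]

/-- A commutator of derivations is a derivation, hence determined by its values on the variables.
All first order commutators below reduce to this check. -/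
theorem derivation_comp_eq {D₁ D₂ D₃ : Derivation ℂ (MvPolynomial ℕ ℂ) (MvPolynomial ℕ ℂ)}
    (h : ∀ k, D₁ (D₂ (X k)) = D₂ (D₁ (X k)) + D₃ (X k)) (f : MvPolynomial ℕ ℂ) :
    D₁ (D₂ f) = D₂ (D₁ f) + D₃ f := by
  have : ⁅D₁, D₂⁆ = D₃ := derivation_ext fun k => by
    rw [Derivation.commutator_apply, h]; ring
  rw [← this, Derivation.commutator_apply]; ring

theorem constDer_comm (c d : ℕ → ℂ) (f : MvPolynomial ℕ ℂ) :
    constDer c (constDer d f) = constDer d (constDer c f) := by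
  have := derivation_comp_eq (D₁ := constDer c) (D₂ := constDer d) (D₃ := 0) (by simp) f
  simpa using this

theorem pderiv_comm (i j : ℕ) (f : MvPolynomial ℕ ℂ) :
    pderiv i (pderiv j f) = pderiv j (pderiv i f) := by
  simp only [pderiv_eq_constDer, constDer_comm]

/-- The commutator of a derivation with constant coefficients and a shift derivation. -/
theorem constDer_shiftDer (c : ℕ → ℂ) (a : ℕ) (f : MvPolynomial ℕ ℂ) :
    constDer c (shiftDer a f) = shiftDer a (constDer c f) +
      constDer (fun k => if a ≤ k + 1 then (2 * ((k + 1 - a : ℕ) : ℂ) + 1) * c (k + 1 - a)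
        else 0) f := by
  refine derivation_comp_eq (fun k => ?_) f
  rw [shiftDer_X]
  split_ifs with h
  · simp [h, smul_eq_C_mul]
  · simp [h]

theorem pderiv_shiftDer_succ (i b : ℕ) (f : MvPolynomial ℕ ℂ) :
    pderiv i (shiftDer (b + 1) f) =
      shiftDer (b + 1) (pderiv i f) + (2 * (i : ℂ) + 1) • pderiv (i + b) f := by
  have := derivation_comp_eq (D₁ := pderiv i) (D₂ := shiftDer (b + 1))
    (D₃ := (2 * (i : ℂ) + 1) • pderiv (i + b)) (fun k => ?_) f
  · simpa using this
  · rw [shiftDer_X, pderiv_X, Derivation.smul_apply, pderiv_X]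
    have h0 : shiftDer (b + 1) ((Pi.single i 1 : ℕ → MvPolynomial ℕ ℂ) k) = 0 := by
      by_cases h : k = i
      · subst h; simp
      · simp [h]
    rw [h0, zero_add]
    by_cases h : k = i + b
    · subst h
      rw [if_pos (by omega), Derivation.map_smul, show i + b + 1 - (b + 1) = i by omega]
      simp
    · rw [Pi.single_eq_of_ne h]
      split_ifs with h1
      · rw [Derivation.map_smul, pderiv_X_of_ne (by omega)]; simp
      · simp

theorem pderiv_succ_shiftDer_zero (i : ℕ) (f : MvPolynomial ℕ ℂ) :
    pderiv (i + 1) (shiftDer 0 f) =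
      shiftDer 0 (pderiv (i + 1) f) + (2 * (i : ℂ) + 3) • pderiv i f := by
  have := derivation_comp_eq (D₁ := pderiv (i + 1)) (D₂ := shiftDer 0)
    (D₃ := (2 * (i : ℂ) + 3) • pderiv i) (fun k => ?_) f
  · simpa using this
  · rw [shiftDer_X, pderiv_X, Derivation.smul_apply, pderiv_X]
    have h0 : shiftDer 0 ((Pi.single (i + 1) 1 : ℕ → MvPolynomial ℕ ℂ) k) = 0 := by
      by_cases h : k = i + 1
      · subst h; simp
      · simp [h]
    rw [h0, zero_add, if_pos (by omega), Derivation.map_smul]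
    by_cases h : k = i
    · subst h
      simp only [Nat.sub_zero, pderiv_X_self, Pi.single_eq_same]
      congr 1; push_cast; ring
    · rw [Pi.single_eq_of_ne h, pderiv_X_of_ne (by omega)]; simp

theorem pderiv_zero_shiftDer_zero (f : MvPolynomial ℕ ℂ) :
    pderiv 0 (shiftDer 0 f) = shiftDer 0 (pderiv 0 f) := by
  have := derivation_comp_eq (D₁ := pderiv 0) (D₂ := shiftDer 0)
    (D₃ := 0) (fun k => ?_) f
  · simpa using this
  · rw [shiftDer_X, pderiv_X]
    have h0 : shiftDer 0 ((Pi.single 0 1 : ℕ → MvPolynomial ℕ ℂ) k) = 0 := by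
      by_cases h : k = 0
      · subst h; simp
      · simp [h]
    rw [h0, if_pos (by omega), Derivation.map_smul, pderiv_X_of_ne (by omega)]; simp

theorem shiftDer_succ_comm (a b : ℕ) (f : MvPolynomial ℕ ℂ) :
    shiftDer (a + 1) (shiftDer (b + 1) f) = shiftDer (b + 1) (shiftDer (a + 1) f) +
      (2 * ((a : ℂ) - b)) • shiftDer (a + b + 1) f := by
  have := derivation_comp_eq (D₁ := shiftDer (a + 1)) (D₂ := shiftDer (b + 1))
    (D₃ := (2 * ((a : ℂ) - b)) • shiftDer (a + b + 1)) (fun k => ?_) f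
  · simpa using this
  · simp only [Derivation.smul_apply]
    by_cases h : a + b ≤ k
    · obtain ⟨c, rfl⟩ := Nat.exists_eq_add_of_le h
      rw [shiftDer_X, shiftDer_X, if_pos (by omega), if_pos (by omega), Derivation.map_smul,
        Derivation.map_smul, shiftDer_X, shiftDer_X, shiftDer_X, if_pos (by omega),
        if_pos (by omega), if_pos (by omega)]
      rw [show a + b + c + 1 - (b + 1) = a + c by omega,
        show a + b + c + 1 - (a + 1) = b + c by omega, show a + c + 1 - (a + 1) = c by omega,
        show b + c + 1 - (b + 1) = c by omega, show a + b + c + 1 - (a + b + 1) = c by omega,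
        smul_smul, smul_smul, smul_smul, ← add_smul]
      congr 1; push_cast; ring
    · rw [shiftDer_X (a + b + 1), if_neg (by omega), smul_zero, add_zero]
      have h0 : ∀ a b : ℕ, k < a + b → shiftDer (a + 1) (shiftDer (b + 1) (X k)) = 0 := by
        intro a b h
        rw [shiftDer_X]
        split_ifs with h1
        · rw [Derivation.map_smul, shiftDer_X, if_neg (by omega), smul_zero]
        · simp
      rw [h0 _ _ (by omega), h0 _ _ (by omega)]

/-- The term with `X 0` is a boundary effect: `shiftDer (b + 2)` kills `X b`, but no longer does so
after `shiftDer 0` has raised the index. On `X b` the identity reads $0=(2b+3)-2(b+2)+1$. -/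
theorem shiftDer_zero_comm_succ_succ (b : ℕ) (f : MvPolynomial ℕ ℂ) :
    shiftDer 0 (shiftDer (b + 2) f) = shiftDer (b + 2) (shiftDer 0 f) +
      (-(2 * ((b : ℂ) + 2)) • shiftDer (b + 1) f + X 0 * pderiv b f) := by
  have := derivation_comp_eq (D₁ := shiftDer 0) (D₂ := shiftDer (b + 2))
    (D₃ := (-(2 * ((b : ℂ) + 2))) • shiftDer (b + 1) + (X 0 : MvPolynomial ℕ ℂ) • pderiv b)
    (fun k => ?_) f
  · simpa using this
  · simp only [Derivation.smul_apply, Derivation.add_apply, smul_eq_mul, pderiv_X]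
    rw [shiftDer_X 0, if_pos (by omega), Derivation.map_smul, shiftDer_X, shiftDer_X (b + 2),
      shiftDer_X (b + 1)]
    rcases lt_trichotomy k b with h | rfl | h
    · rw [if_neg (by omega), if_neg (by omega), if_neg (by omega), Pi.single_eq_of_ne (by omega)]
      simp
    · rw [if_neg (by omega), if_pos (by omega), if_pos (by omega), Pi.single_eq_same,
        show k + 1 - 0 + 1 - (k + 2) = 0 by omega, show k + 1 - (k + 1) = 0 by omega, smul_smul,
        smul_smul, map_zero, mul_one]
      rw [← one_smul ℂ (X 0 : MvPolynomial ℕ ℂ), smul_smul, smul_smul, ← add_smul, ← add_smul]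
      symm
      convert zero_smul ℂ _ using 2
      push_cast; ring
    · obtain ⟨c, rfl⟩ := Nat.exists_eq_add_of_lt h
      rw [if_pos (by omega), if_pos (by omega), if_pos (by omega), Pi.single_eq_of_ne (by omega),
        Derivation.map_smul, shiftDer_X, if_pos (by omega)]
      rw [show b + c + 1 + 1 - (b + 2) = c by omega,
        show b + c + 1 + 1 - 0 + 1 - (b + 2) = c + 1 by omega, show c + 1 - 0 = c + 1 by omega,
        show b + c + 1 + 1 - (b + 1) = c + 1 by omega, mul_zero, add_zero,
        smul_smul, smul_smul, smul_smul, ← add_smul]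
      congr 1; push_cast [show b + c + 1 + 1 - 0 = b + c + 2 by omega]; ring

theorem shiftDer_zero_comm_one (f : MvPolynomial ℕ ℂ) :
    shiftDer 0 (shiftDer 1 f) = shiftDer 1 (shiftDer 0 f) + (-2 : ℂ) • shiftDer 0 f := by
  have := derivation_comp_eq (D₁ := shiftDer 0) (D₂ := shiftDer 1)
    (D₃ := (-2 : ℂ) • shiftDer 0) (fun k => ?_) f
  · simpa using this
  · simp only [Derivation.smul_apply]
    rw [shiftDer_X 0, shiftDer_X 1, if_pos (by omega), if_pos (by omega), Derivation.map_smul,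
      Derivation.map_smul, shiftDer_X, shiftDer_X, if_pos (by omega), if_pos (by omega)]
    rw [show k + 1 - 1 = k by omega, show k + 1 - 0 = k + 1 by omega,
      show k + 1 + 1 - 1 = k + 1 by omega, smul_smul, smul_smul, smul_smul, ← add_smul]
    congr 1; push_cast; ring

/-! ### Commutators of the second order part -/

theorem pderiv_secondOrder (i a : ℕ) (f : MvPolynomial ℕ ℂ) :
    pderiv i (secondOrder a f) = secondOrder a (pderiv i f) := by
  rw [secondOrder_apply, secondOrder_apply, Derivation.map_smul, map_sum]
  refine congrArg _ (Finset.sum_congr rfl fun j _ => ?_)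
  rw [pderiv_comm i j, pderiv_comm i]

theorem secondOrder_comm (a b : ℕ) (f : MvPolynomial ℕ ℂ) :
    secondOrder a (secondOrder b f) = secondOrder b (secondOrder a f) := by
  rw [secondOrder_apply a, secondOrder_apply a, map_smul, map_sum]
  simp only [pderiv_secondOrder]

/-- Symmetric sums of second derivatives. -/
theorem sum_pderiv_symm (n : ℕ) (f : MvPolynomial ℕ ℂ) (w : ℕ → ℂ) :
    (2 : ℂ) • ∑ i ∈ Finset.range n, w i • pderiv i (pderiv (n - 1 - i) f) =
      ∑ i ∈ Finset.range n, (w i + w (n - 1 - i)) • pderiv i (pderiv (n - 1 - i) f) := by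
  have h : ∑ i ∈ Finset.range n, w (n - 1 - i) • pderiv i (pderiv (n - 1 - i) f) =
      ∑ i ∈ Finset.range n, w i • pderiv i (pderiv (n - 1 - i) f) := by
    rw [← Finset.sum_range_reflect]
    refine Finset.sum_congr rfl fun i hi => ?_
    have := Finset.mem_range.1 hi
    rw [show n - 1 - (n - 1 - i) = i by omega, pderiv_comm]
  simp only [add_smul, Finset.sum_add_distrib, h, two_smul]

theorem secondOrder_shiftDer_succ (a b : ℕ) (f : MvPolynomial ℕ ℂ) :
    secondOrder (a + 1) (shiftDer (b + 1) f) = shiftDer (b + 1) (secondOrder (a + 1) f) +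
      ∑ i ∈ Finset.range a, (2 * (i : ℂ) + 1) • pderiv (i + b) (pderiv (a - 1 - i) f) := by
  have h1 : ∑ i ∈ Finset.range a,
      (2 * ((a - 1 - i : ℕ) : ℂ) + 1) • pderiv i (pderiv (a - 1 - i + b) f) =
      ∑ i ∈ Finset.range a, (2 * (i : ℂ) + 1) • pderiv (i + b) (pderiv (a - 1 - i) f) := by
    rw [← Finset.sum_range_reflect]
    refine Finset.sum_congr rfl fun i hi => ?_
    have := Finset.mem_range.1 hi
    rw [show a - 1 - (a - 1 - i) = i by omega, pderiv_comm]
  simp only [secondOrder_apply, Derivation.map_smul, map_sum, pderiv_shiftDer_succ, map_add,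
    Finset.sum_add_distrib, show a + 1 - 1 = a by omega, show a + 1 - 2 = a - 1 by omega]
  rw [h1, add_assoc, smul_add, ← two_smul ℂ, smul_smul]
  norm_num

theorem secondOrder_shiftDer_zero (a : ℕ) (f : MvPolynomial ℕ ℂ) :
    secondOrder (a + 2) (shiftDer 0 f) = shiftDer 0 (secondOrder (a + 2) f) +
      ((a : ℂ) + 2) • (2 : ℂ) • secondOrder (a + 1) f := by
  have h2 : ∑ i ∈ Finset.range (a + 1), pderiv i (pderiv (a - i) (shiftDer 0 f)) =
      shiftDer 0 (∑ i ∈ Finset.range (a + 1), pderiv i (pderiv (a - i) f)) +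
      ((∑ i ∈ Finset.range a, (2 * ((a - 1 - i : ℕ) : ℂ) + 3) • pderiv i (pderiv (a - 1 - i) f)) +
        ∑ i ∈ Finset.range a, (2 * (i : ℂ) + 3) • pderiv i (pderiv (a - 1 - i) f)) := by
    have h3 : ∀ i ∈ Finset.range (a + 1), pderiv i (pderiv (a - i) (shiftDer 0 f)) =
        shiftDer 0 (pderiv i (pderiv (a - i) f)) +
        ((if i < a then (2 * ((a - 1 - i : ℕ) : ℂ) + 3) • pderiv i (pderiv (a - 1 - i) f) else 0) +
        (if 0 < i then (2 * ((i - 1 : ℕ) : ℂ) + 3) • pderiv (i - 1) (pderiv (a - i) f) else 0)) := by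
      intro i hi
      have h4 : ∀ g : MvPolynomial ℕ ℂ, pderiv i (shiftDer 0 g) = shiftDer 0 (pderiv i g) +
          if 0 < i then (2 * ((i - 1 : ℕ) : ℂ) + 3) • pderiv (i - 1) g else 0 := by
        intro g
        rcases i with _ | i
        · simp [pderiv_zero_shiftDer_zero]
        · simp [pderiv_succ_shiftDer_zero]
      rcases Nat.lt_or_ge i a with h | h
      · obtain ⟨c, hc⟩ : ∃ c, a - i = c + 1 := ⟨a - i - 1, by omega⟩
        rw [hc, pderiv_succ_shiftDer_zero, map_add, h4, if_pos h, Derivation.map_smul,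
          show a - 1 - i = c by omega]
        abel
      · rw [if_neg (by omega), show a - i = 0 by omega, pderiv_zero_shiftDer_zero, h4, zero_add]
    rw [Finset.sum_congr rfl h3, Finset.sum_add_distrib, Finset.sum_add_distrib, map_sum]
    congr 2
    · rw [Finset.sum_range_succ, if_neg (by omega), add_zero]
      exact Finset.sum_congr rfl fun i hi => by rw [if_pos (Finset.mem_range.1 hi)]
    · rw [Finset.sum_range_succ', if_neg (by omega), add_zero]
      refine Finset.sum_congr rfl fun i hi => ?_
      rw [if_pos (by omega), show i + 1 - 1 = i by omega, show a - (i + 1) = a - 1 - i by omega]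
  simp only [secondOrder_apply, Derivation.map_smul, show a + 2 - 1 = a + 1 by omega,
    show a + 2 - 2 = a by omega, show a + 1 - 1 = a by omega, show a + 1 - 2 = a - 1 by omega]
  rw [h2, smul_add, ← Finset.sum_add_distrib, smul_smul, smul_smul, Finset.smul_sum, Finset.smul_sum]
  refine congrArg _ (Finset.sum_congr rfl fun i hi => ?_)
  have h := Finset.mem_range.1 hi
  obtain ⟨c, rfl⟩ : ∃ c, a = c + 1 + i := ⟨a - 1 - i, by omega⟩
  rw [← add_smul, smul_smul, show c + 1 + i - 1 - i = c by omega]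
  congr 1
  push_cast; ring

/-- Only the antisymmetric combination closes up: each single commutator is a weighted sum of second
derivatives, and the two sums together fill the range `a + b`. -/
theorem secondOrder_shiftDer_comm (a b : ℕ) (f : MvPolynomial ℕ ℂ) :
    secondOrder (a + 1) (shiftDer (b + 1) f) + shiftDer (a + 1) (secondOrder (b + 1) f) =
      secondOrder (b + 1) (shiftDer (a + 1) f) + shiftDer (b + 1) (secondOrder (a + 1) f) +
      (2 * ((a : ℂ) - b)) • secondOrder (a + b + 1) f := by
  have h1 : ∀ a b : ℕ,
      ∑ i ∈ Finset.range a, (2 * (i : ℂ) + 1) • pderiv (i + b) (pderiv (a - 1 - i) f) =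
      ∑ i ∈ Finset.range a,
        (2 * (a : ℂ) - 1 - 2 * i) • pderiv i (pderiv (a + b - 1 - i) f) := by
    intro a b
    rw [← Finset.sum_range_reflect]
    refine Finset.sum_congr rfl fun i hi => ?_
    have h := Finset.mem_range.1 hi
    obtain ⟨c, rfl⟩ : ∃ c, a = c + 1 + i := ⟨a - 1 - i, by omega⟩
    rw [show c + 1 + i - 1 - i = c by omega, show c + 1 + i - 1 - c = i by omega,
      show c + 1 + i + b - 1 - i = c + b by omega, pderiv_comm]
    congr 1
    push_cast; ring
  rw [secondOrder_shiftDer_succ, secondOrder_shiftDer_succ, h1, h1]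
  -- Second derivatives commute, so a weight may be averaged with its reflection; the average of
  -- $2a-1-2i$ is the constant $a-b$.
  have h2 : ∑ i ∈ Finset.range (a + b),
      (2 * (a : ℂ) - 1 - 2 * i) • pderiv i (pderiv (a + b - 1 - i) f) =
      ((a : ℂ) - b) • ∑ i ∈ Finset.range (a + b), pderiv i (pderiv (a + b - 1 - i) f) := by
    have h3 := sum_pderiv_symm (a + b) f fun i => 2 * (a : ℂ) - 1 - 2 * i
    have h4 : ∀ i ∈ Finset.range (a + b), (2 * (a : ℂ) - 1 - 2 * i +
        (2 * (a : ℂ) - 1 - 2 * ((a + b - 1 - i : ℕ) : ℂ))) • pderiv i (pderiv (a + b - 1 - i) f) =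
        (2 : ℂ) • ((a : ℂ) - b) • pderiv i (pderiv (a + b - 1 - i) f) := by
      intro i hi
      have h := Finset.mem_range.1 hi
      rw [smul_smul]
      congr 1
      rw [Nat.cast_sub (by omega), Nat.cast_sub (by omega)]
      push_cast; ring
    rw [Finset.sum_congr rfl h4, ← Finset.smul_sum, ← Finset.smul_sum] at h3
    exact (smul_right_injective (MvPolynomial ℕ ℂ) (two_ne_zero : (2 : ℂ) ≠ 0)) h3
  rw [Finset.sum_range_add] at h2
  -- The upper part of the range, reflected, is minus the corresponding sum with `a` and `b`
  -- exchanged.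
  have h5 : ∑ x ∈ Finset.range b,
      (2 * (a : ℂ) - 1 - 2 * ((a + x : ℕ) : ℂ)) • pderiv (a + x) (pderiv (a + b - 1 - (a + x)) f) =
      -∑ i ∈ Finset.range b,
        (2 * (b : ℂ) - 1 - 2 * i) • pderiv i (pderiv (b + a - 1 - i) f) := by
    rw [← Finset.sum_range_reflect, ← Finset.sum_neg_distrib]
    refine Finset.sum_congr rfl fun i hi => ?_
    have h := Finset.mem_range.1 hi
    obtain ⟨c, rfl⟩ : ∃ c, b = c + 1 + i := ⟨b - 1 - i, by omega⟩
    rw [show c + 1 + i - 1 - i = c by omega, show a + (c + 1 + i) - 1 - (a + c) = i by omega,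
      show c + 1 + i + a - 1 - i = a + c by omega, pderiv_comm, ← neg_smul]
    congr 1
    push_cast; ring
  rw [h5] at h2
  simp only [secondOrder_apply, show a + b + 1 - 1 = a + b by omega,
    show a + b + 1 - 2 = a + b - 1 by omega]
  rw [smul_smul, show 2 * ((a : ℂ) - b) * (1 / 2) = a - b by ring, ← h2]
  abel

/-! ### The potentials and the Virasoro relations. -/

theorem pderiv_potential_zero (i : ℕ) : pderiv i (potential 0) = if i = 0 then X 0 else 0 := by
  rw [potential, if_pos rfl, Derivation.map_smul, pow_two, Derivation.leibniz]
  by_cases h : i = 0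
  · subst h
    rw [pderiv_X_self, if_pos rfl, ← two_smul ℂ, smul_smul, smul_eq_mul]
    norm_num
  · rw [pderiv_X_of_ne (Ne.symm h), if_neg h]; simp

/-- The term `X 0 * pderiv n f` cancels the boundary term of `shiftDer_zero_comm_succ_succ`. The
constant, present when both derivatives hit $X_0^2/2$, is what forces the value 1/8 of the potential
with index 1. -/
theorem secondOrder_potential_zero (n : ℕ) (f : MvPolynomial ℕ ℂ) :
    secondOrder (n + 2) (potential 0 * f) = potential 0 * secondOrder (n + 2) f +
      X 0 * pderiv n f + if n = 0 then (1 / 2 : ℂ) • f else 0 := by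
  have h1 : ∀ i ∈ Finset.range (n + 1), pderiv i (pderiv (n - i) (potential 0 * f)) =
      potential 0 * pderiv i (pderiv (n - i) f) + (if i = 0 then X 0 * pderiv n f else 0) +
      (if i = n then X 0 * pderiv n f else 0) + if i = 0 then (if n = 0 then f else 0) else 0 := by
    intro i hi
    have hi := Finset.mem_range.1 hi
    rw [pderiv_mul, map_add, pderiv_mul, pderiv_mul, pderiv_potential_zero,
      pderiv_potential_zero]
    rcases Nat.eq_zero_or_pos i with rfl | hi0
    · rcases Nat.eq_zero_or_pos n with rfl | hn
      · simp; ring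
      · simp [hn.ne', hn.ne]; ring
    · rcases Nat.lt_or_ge i n with h | h
      · simp [hi0.ne', h.ne, show n - i ≠ 0 by omega]
      · obtain rfl : i = n := by omega
        simp [hi0.ne', pderiv_X_of_ne hi0.ne]
        ring
  rw [secondOrder_apply, secondOrder_apply]
  simp only [show n + 2 - 1 = n + 1 by omega, show n + 2 - 2 = n by omega]
  rw [Finset.sum_congr rfl h1]
  simp only [Finset.sum_add_distrib, ← Finset.mul_sum]
  rw [Finset.sum_ite_eq' (Finset.range (n + 1)), Finset.sum_ite_eq' (Finset.range (n + 1)),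
    Finset.sum_ite_eq' (Finset.range (n + 1)), if_pos (by simp), if_pos (by simp),
    if_pos (by simp)]
  rw [smul_add, smul_add, smul_add, mul_smul_comm, add_assoc (potential 0 * _ |> ((1 / 2 : ℂ) • ·)),
    ← add_smul]
  split_ifs <;> norm_num

theorem shiftDer_potential_zero (b : ℕ) :
    shiftDer (b + 1) (potential 0) = if b = 0 then (2 : ℂ) • potential 0 else 0 := by
  rw [potential, if_pos rfl, Derivation.map_smul, pow_two, Derivation.leibniz, shiftDer_X]
  rcases b with _ | b
  · simp only [zero_add, le_refl, if_true, Nat.sub_self, CharP.cast_eq_zero, mul_zero, one_smul,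
      ← two_smul ℂ, smul_comm (2 : ℂ), smul_eq_mul]
  · simp

theorem potential_succ (a : ℕ) : potential (a + 1) = C (if a = 0 then 1 / 8 else 0) := by
  rw [potential, if_neg (by omega)]
  by_cases h : a = 0 <;> simp [h]

theorem virasoro_succ (a : ℕ) (f : MvPolynomial ℕ ℂ) : virasoro (a + 1) f =
    secondOrder (a + 1) f + shiftDer (a + 1) f + (if a = 0 then 1 / 8 else 0 : ℂ) • f := by
  rw [virasoro_apply, potential_succ, smul_eq_C_mul]

theorem secondOrder_zero (f : MvPolynomial ℕ ℂ) : secondOrder 0 f = 0 := by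
  simp [secondOrder_apply]

theorem secondOrder_one (f : MvPolynomial ℕ ℂ) : secondOrder 1 f = 0 := by
  simp [secondOrder_apply]

theorem virasoro_zero (f : MvPolynomial ℕ ℂ) :
    virasoro 0 f = shiftDer 0 f + potential 0 * f := by
  rw [virasoro_apply, secondOrder_zero, zero_add]

theorem virasoro_one (f : MvPolynomial ℕ ℂ) :
    virasoro 1 f = shiftDer 1 f + (1 / 8 : ℂ) • f := by
  rw [virasoro_succ, secondOrder_one, zero_add, if_pos rfl]

/-- The Virasoro relations. -/
theorem virasoro_succ_comm (a b : ℕ) (f : MvPolynomial ℕ ℂ) :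
    virasoro (a + 1) (virasoro (b + 1) f) = virasoro (b + 1) (virasoro (a + 1) f) +
      (2 * ((a : ℂ) - b)) • virasoro (a + b + 1) f := by
  have h : (2 * ((a : ℂ) - b)) • (if a + b = 0 then 1 / 8 else 0 : ℂ) • f = 0 := by
    split_ifs with h
    · obtain ⟨rfl, rfl⟩ : a = 0 ∧ b = 0 := by omega
      simp
    · simp
  rw [virasoro_succ (a + b), smul_add, h, virasoro_succ, virasoro_succ, virasoro_succ b,
    virasoro_succ a f]
  simp only [map_add, map_smul, Derivation.map_smul, smul_add]
  have h1 := secondOrder_shiftDer_comm a b f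
  have h2 := shiftDer_succ_comm a b f
  have h3 := secondOrder_comm (a + 1) (b + 1) f
  rw [h2, h3, smul_comm]
  linear_combination (exp := 1) h1

theorem virasoro_zero_comm (b : ℕ) (f : MvPolynomial ℕ ℂ) :
    virasoro 0 (virasoro (b + 1) f) = virasoro (b + 1) (virasoro 0 f) -
      (2 * ((b : ℂ) + 1)) • virasoro b f := by
  have hs := shiftDer_potential_zero b
  rcases b with _ | n
  · have h := shiftDer_zero_comm_one f
    simp only [zero_add, if_true] at hs
    rw [zero_add, virasoro_one, virasoro_one, virasoro_zero, virasoro_zero]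
    simp only [map_add, Derivation.map_smul, smul_add, Derivation.leibniz, smul_eq_mul, h, hs,
      mul_add]
    simp only [smul_eq_C_mul]
    simp only [CharP.cast_eq_zero, mul_one, C_neg]
    ring_nf
  · have h := shiftDer_zero_comm_succ_succ n f
    have h2 := secondOrder_shiftDer_zero n f
    have h3 := secondOrder_potential_zero n f
    rw [if_neg (by omega)] at hs
    -- The constants match because $2\cdot 2\cdot\frac18=\frac12$.
    have h4 : (2 * (((n + 1 : ℕ) : ℂ) + 1)) • (if n = 0 then 1 / 8 else 0 : ℂ) • f =
        if n = 0 then (1 / 2 : ℂ) • f else 0 := by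
      split_ifs with h
      · subst h; rw [smul_smul]; norm_num
      · simp
    have h5 : (2 * (((n + 1 : ℕ) : ℂ) + 1)) = 2 * ((n : ℂ) + 2) := by push_cast; ring
    rw [virasoro_succ n, smul_add, h4, virasoro_succ, virasoro_succ, virasoro_zero,
      virasoro_zero, if_neg (by omega)]
    rw [h5]
    simp only [map_add, Derivation.leibniz, smul_eq_mul, h, h2, h3, hs, mul_add, zero_smul,
      add_zero, mul_zero, smul_add]
    simp only [smul_eq_C_mul, neg_smul, C_mul, C_add]
    ring

theorem pderiv_virasoro_succ (i b : ℕ) (f : MvPolynomial ℕ ℂ) :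
    pderiv i (virasoro (b + 1) f) =
      virasoro (b + 1) (pderiv i f) + (2 * (i : ℂ) + 1) • pderiv (i + b) f := by
  rw [virasoro_succ, virasoro_succ, map_add, map_add, Derivation.map_smul, pderiv_secondOrder,
    pderiv_shiftDer_succ]
  abel

theorem pderiv_succ_virasoro_zero (i : ℕ) (f : MvPolynomial ℕ ℂ) :
    pderiv (i + 1) (virasoro 0 f) =
      virasoro 0 (pderiv (i + 1) f) + (2 * (i : ℂ) + 3) • pderiv i f := by
  rw [virasoro_zero, virasoro_zero, map_add, pderiv_succ_shiftDer_zero, pderiv_mul,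
    pderiv_potential_zero, if_neg (by omega)]
  ring

/-- If all first derivatives of `f` come from the Virasoro operators, the form with the
coefficients `virasoro i f` is closed. -/
theorem pderiv_virasoro_symm {f f' : MvPolynomial ℕ ℂ} (h : ∀ k, pderiv k f = virasoro k f')
    (i j : ℕ) : pderiv i (virasoro j f) = pderiv j (virasoro i f) := by
  have h0 : ∀ b, pderiv 0 (virasoro (b + 1) f) = pderiv (b + 1) (virasoro 0 f) := by
    intro b
    rw [pderiv_virasoro_succ, pderiv_succ_virasoro_zero, h, h, h, virasoro_zero_comm, zero_add]
    simp only [smul_eq_C_mul, C_add, C_mul, CharP.cast_eq_zero, C_1, C_0, h]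
    simp only [map_natCast, map_ofNat]
    ring
  rcases i with _ | a <;> rcases j with _ | b
  · rfl
  · exact h0 b
  · exact (h0 a).symm
  -- Once the derivatives of `f` are replaced by Virasoro operators on `f'`, the difference of the
  -- two sides is a commutator plus $2(a-b)$ times `virasoro (a + b + 1) f'`, and these cancel.
  · rw [pderiv_virasoro_succ, pderiv_virasoro_succ, h, h, h, h, virasoro_succ_comm,
      show a + 1 + b = a + b + 1 by omega, show b + 1 + a = a + b + 1 by omega]
    simp only [smul_eq_C_mul, C_add, C_mul, C_sub, C_1, map_natCast, map_ofNat, Nat.cast_add,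
      Nat.cast_one]
    ring_nf

theorem euler_virasoro (a : ℕ) (f : MvPolynomial ℕ ℂ) :
    shiftDer 1 (virasoro a f) = virasoro a (shiftDer 1 f) + (2 - 2 * (a : ℂ)) • virasoro a f := by
  have h1 : ∀ g, shiftDer 1 g = virasoro 1 g - (1 / 8 : ℂ) • g := fun g => by
    rw [virasoro_one]; abel
  rw [h1, h1 f, map_sub, map_smul]
  rcases a with _ | a
  · have := virasoro_zero_comm 0 f
    rw [zero_add] at this
    rw [this]
    simp only [CharP.cast_eq_zero, mul_zero, zero_add, mul_one, sub_zero]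
    abel
  · have := virasoro_succ_comm 0 a f
    rw [zero_add, zero_add] at this
    rw [this]
    simp only [smul_eq_C_mul, CharP.cast_eq_zero]
    simp only [C_add, C_mul, C_sub, C_0, C_1, map_natCast, map_ofNat, Nat.cast_add, Nat.cast_one]
    ring

/-! ### Polynomials in finitely many variables -/

theorem supportedIio_mono {K L : ℕ} (h : K ≤ L) {f : MvPolynomial ℕ ℂ}
    (hf : f ∈ supported ℂ (Set.Iio K)) : f ∈ supported ℂ (Set.Iio L) :=
  supported_mono (Set.Iio_subset_Iio h) hf

theorem exists_mem_supported (f : MvPolynomial ℕ ℂ) : ∃ K, f ∈ supported ℂ (Set.Iio K) := by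
  obtain ⟨K, hK⟩ := f.vars.bddAbove
  exact ⟨K + 1, mem_supported.2 fun k hk => Nat.lt_succ_of_le (hK hk)⟩

theorem derivation_mem_supported {D : Derivation ℂ (MvPolynomial ℕ ℂ) (MvPolynomial ℕ ℂ)}
    {K L : ℕ} (hKL : K ≤ L) (hD : ∀ k < K, D (X k) ∈ supported ℂ (Set.Iio L))
    {f : MvPolynomial ℕ ℂ} (hf : f ∈ supported ℂ (Set.Iio K)) :
    D f ∈ supported ℂ (Set.Iio L) := by
  rw [supported_eq_adjoin_X] at hf
  induction hf using Algebra.adjoin_induction with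
  | mem x hx =>
    obtain ⟨k, hk, rfl⟩ := hx
    exact hD k hk
  | algebraMap r => simp [zero_mem]
  | add x y _ _ hx hy => rw [map_add]; exact add_mem hx hy
  | mul x y hx' hy' hx hy =>
    rw [Derivation.leibniz]
    rw [← supported_eq_adjoin_X] at hx' hy'
    exact add_mem (mul_mem (supportedIio_mono hKL hx') hy)
      (mul_mem (supportedIio_mono hKL hy') hx)

theorem constDer_mem_supported (c : ℕ → ℂ) {K : ℕ} {f : MvPolynomial ℕ ℂ}
    (hf : f ∈ supported ℂ (Set.Iio K)) : constDer c f ∈ supported ℂ (Set.Iio K) :=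
  derivation_mem_supported le_rfl (fun k _ => by
    rw [constDer_X]; exact Subalgebra.algebraMap_mem _ _) hf

theorem pderiv_mem_supported (i : ℕ) {K : ℕ} {f : MvPolynomial ℕ ℂ}
    (hf : f ∈ supported ℂ (Set.Iio K)) : pderiv i f ∈ supported ℂ (Set.Iio K) := by
  rw [pderiv_eq_constDer]; exact constDer_mem_supported _ hf

theorem pderiv_eq_zero_of_mem_supported {i K : ℕ} (h : K ≤ i) {f : MvPolynomial ℕ ℂ}
    (hf : f ∈ supported ℂ (Set.Iio K)) : pderiv i f = 0 :=
  pderiv_eq_zero_of_notMem_vars fun hi => absurd (mem_supported.1 hf hi) (not_lt.2 h)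

theorem virasoro_mem_supported (a : ℕ) {K : ℕ} {f : MvPolynomial ℕ ℂ}
    (hf : f ∈ supported ℂ (Set.Iio K)) : virasoro a f ∈ supported ℂ (Set.Iio (K + 1)) := by
  rw [virasoro_apply]
  refine add_mem (add_mem ?_ ?_) (mul_mem ?_ (supportedIio_mono (Nat.le_succ K) hf))
  · rw [secondOrder_apply]
    exact Subalgebra.smul_mem _ (sum_mem fun i _ => supportedIio_mono (Nat.le_succ K)
      (pderiv_mem_supported _ (pderiv_mem_supported _ hf))) _
  · refine derivation_mem_supported (Nat.le_succ K) (fun k hk => ?_) hf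
    rw [shiftDer_X]
    split_ifs
    · exact Subalgebra.smul_mem _ (X_mem_supported.2 (Set.mem_Iio.2 (by omega))) _
    · exact zero_mem _
  · rw [potential]
    split_ifs
    · exact Subalgebra.smul_mem _ (pow_mem (X_mem_supported.2 (Set.mem_Iio.2 (by omega))) _) _
    · exact Subalgebra.algebraMap_mem _ _
    · exact zero_mem _

/-- This makes the sums over all `a` finite: in the second order part one of two indices with sum at
least `2 * K` is at least `K`, and the shift exceeds every variable present. -/
theorem virasoro_eq_zero {a K : ℕ} (h : 2 * K + 2 ≤ a) {f : MvPolynomial ℕ ℂ}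
    (hf : f ∈ supported ℂ (Set.Iio K)) : virasoro a f = 0 := by
  have h1 : secondOrder a f = 0 := by
    rw [secondOrder_apply, Finset.sum_eq_zero, smul_zero]
    intro i hi
    have := Finset.mem_range.1 hi
    rcases Nat.lt_or_ge i K with h | h
    · rw [pderiv_eq_zero_of_mem_supported (by omega) hf, map_zero]
    · rw [pderiv_comm, pderiv_eq_zero_of_mem_supported h hf, map_zero]
  have h2 : shiftDer a f = 0 := by
    refine derivation_eq_zero_of_forall_mem_vars fun k hk => ?_
    have : k < K := mem_supported.1 hf hk
    rw [shiftDer_X, if_neg (by omega)]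
  rw [virasoro_apply, h1, h2, potential, if_neg (by omega), if_neg (by omega)]
  simp

theorem sum_derivation_apply {ι : Type*} (s : Finset ι)
    (D : ι → Derivation ℂ (MvPolynomial ℕ ℂ) (MvPolynomial ℕ ℂ)) (f : MvPolynomial ℕ ℂ) :
    (∑ i ∈ s, D i) f = ∑ i ∈ s, D i f := by
  classical
  induction s using Finset.induction_on with
  | empty => simp
  | insert i s hi ih => rw [Finset.sum_insert hi, Finset.sum_insert hi, Derivation.add_apply, ih]

theorem euler_eq_sum {K : ℕ} {f : MvPolynomial ℕ ℂ} (hf : f ∈ supported ℂ (Set.Iio K)) :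
    shiftDer 1 f = ∑ a ∈ Finset.range K, (2 * (a : ℂ) + 1) • (X a * pderiv a f) := by
  have h : shiftDer 1 f =
      (∑ a ∈ Finset.range K, ((2 * (a : ℂ) + 1) • (X a : MvPolynomial ℕ ℂ)) • pderiv a :
        Derivation ℂ (MvPolynomial ℕ ℂ) (MvPolynomial ℕ ℂ)) f := by
    refine derivation_eqOn_supported (fun k hk => ?_) hf
    simp only [Function.comp_apply]
    rw [shiftDer_X, if_pos (by omega), sum_derivation_apply,
      Finset.sum_eq_single_of_mem k (Finset.mem_range.2 hk)]
    · simp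
    · intro b _ hb
      rw [Derivation.smul_apply, pderiv_X_of_ne hb.symm, smul_zero]
  rw [h, sum_derivation_apply]
  simp

theorem constDer_eq_sum (c : ℕ → ℂ) {K : ℕ} {f : MvPolynomial ℕ ℂ}
    (hf : f ∈ supported ℂ (Set.Iio K)) :
    constDer c f = ∑ a ∈ Finset.range K, c a • pderiv a f := by
  have h : constDer c f = (∑ a ∈ Finset.range K, c a • pderiv a :
        Derivation ℂ (MvPolynomial ℕ ℂ) (MvPolynomial ℕ ℂ)) f := by
    refine derivation_eqOn_supported (fun k hk => ?_) hf
    simp only [Function.comp_apply]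
    rw [constDer_X, sum_derivation_apply,
      Finset.sum_eq_single_of_mem k (Finset.mem_range.2 hk)]
    · simp [smul_eq_C_mul]
    · intro b _ hb
      rw [Derivation.smul_apply, pderiv_X_of_ne hb.symm, smul_zero]
  rw [h, sum_derivation_apply]
  simp

/-! ### The partition function -/

/-- A bound for the variables of the `m`-th coefficient of the partition function. -/
def varBound : ℕ → ℕ
  | 0 => 0
  | m + 1 => 2 * varBound m + 2

/-- The coefficients of the partition function of the Airy curve. -/
def partitionCoeff : ℕ → MvPolynomial ℕ ℂ
  | 0 => 1
  | m + 1 => (1 / (3 * ((m : ℂ) + 1))) • ∑ a ∈ Finset.range (2 * varBound m + 2),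
      (2 * (a : ℂ) + 1) • (X a * virasoro a (partitionCoeff m))

theorem partitionCoeff_mem_supported (m : ℕ) :
    partitionCoeff m ∈ supported ℂ (Set.Iio (varBound m)) := by
  induction m with
  | zero => exact one_mem _
  | succ m ih =>
    rw [partitionCoeff, varBound]
    refine Subalgebra.smul_mem _ (sum_mem fun a ha => Subalgebra.smul_mem _ (mul_mem ?_ ?_) _) _
    · exact X_mem_supported.2 (Finset.mem_range.1 ha)
    · exact supportedIio_mono (by omega) (virasoro_mem_supported a ih)

/-- The Poincaré lemma in homogeneous form: a closed form with coefficients of the right weights is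
the differential of its contraction with the Euler field, divided by the total weight. -/
theorem pderiv_partitionCoeff_aux (m : ℕ) {f' : MvPolynomial ℕ ℂ}
    (he : shiftDer 1 (partitionCoeff m) = (3 * (m : ℂ)) • partitionCoeff m)
    (hf' : ∀ k, pderiv k (partitionCoeff m) = virasoro k f') (b : ℕ) :
    pderiv b (partitionCoeff (m + 1)) = virasoro b (partitionCoeff m) := by
  have hm := partitionCoeff_mem_supported m
  set Z := partitionCoeff m with hZ
  set K := varBound m
  have h1 : ∑ a ∈ Finset.range (2 * K + 2), (2 * (a : ℂ) + 1) • (X a * pderiv a (virasoro b Z)) =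
      (3 * (m : ℂ) + (2 - 2 * b)) • virasoro b Z := by
    rw [← euler_eq_sum (supportedIio_mono (by omega) (virasoro_mem_supported b hm)),
      euler_virasoro, he, map_smul, ← add_smul]
  have h2 : ∑ a ∈ Finset.range (2 * K + 2),
      (2 * (a : ℂ) + 1) • (pderiv b (X a) * virasoro a Z) = (2 * (b : ℂ) + 1) • virasoro b Z := by
    rcases Nat.lt_or_ge b (2 * K + 2) with h | h
    · rw [Finset.sum_eq_single_of_mem b (Finset.mem_range.2 h)]
      · simp
      · intro a _ ha
        rw [pderiv_X_of_ne ha, zero_mul, smul_zero]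
    · rw [virasoro_eq_zero h hm, smul_zero]
      refine Finset.sum_eq_zero fun a ha => ?_
      have := Finset.mem_range.1 ha
      rw [pderiv_X_of_ne (by omega), zero_mul, smul_zero]
  rw [partitionCoeff, Derivation.map_smul, map_sum]
  have h3 : ∀ a ∈ Finset.range (2 * K + 2),
      pderiv b ((2 * (a : ℂ) + 1) • (X a * virasoro a Z)) =
        (2 * (a : ℂ) + 1) • (pderiv b (X a) * virasoro a Z) +
        (2 * (a : ℂ) + 1) • (X a * pderiv a (virasoro b Z)) := by
    intro a _
    rw [Derivation.map_smul, pderiv_mul, pderiv_virasoro_symm hf' b a, smul_add]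
  -- The total factor $(3m+2-2b)+(2b+1)=3(m+1)$ does not depend on `b`, which explains the
  -- normalization in `partitionCoeff`.
  rw [Finset.sum_congr rfl h3, Finset.sum_add_distrib, h1, h2, ← add_smul, smul_smul]
  convert one_smul ℂ _
  have : (m : ℂ) + 1 ≠ 0 := Nat.cast_add_one_ne_zero m
  field_simp
  ring

theorem euler_partitionCoeff_aux (m : ℕ)
    (h : ∀ b, pderiv b (partitionCoeff (m + 1)) = virasoro b (partitionCoeff m)) :
    shiftDer 1 (partitionCoeff (m + 1)) = (3 * ((m + 1 : ℕ) : ℂ)) • partitionCoeff (m + 1) := by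
  rw [euler_eq_sum (partitionCoeff_mem_supported (m + 1))]
  simp only [h]
  rw [partitionCoeff, smul_smul, varBound]
  have : (m : ℂ) + 1 ≠ 0 := Nat.cast_add_one_ne_zero m
  rw [show (3 * ((m + 1 : ℕ) : ℂ)) * (1 / (3 * ((m : ℂ) + 1))) = 1 by push_cast; field_simp,
    one_smul]

/-- Homogeneity and closedness at one order yield the constraint at the next, which yields both
again. The witness `f'` is the previous coefficient, or 0 at the start, where all derivatives of 1
vanish. -/
theorem partitionCoeff_aux (m : ℕ) :
    shiftDer 1 (partitionCoeff m) = (3 * (m : ℂ)) • partitionCoeff m ∧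
      ∃ f', ∀ k, pderiv k (partitionCoeff m) = virasoro k f' := by
  induction m with
  | zero => exact ⟨by simp [partitionCoeff], 0, by simp [partitionCoeff]⟩
  | succ m ih =>
    obtain ⟨h1, f', h2⟩ := ih
    have h3 := pderiv_partitionCoeff_aux m h1 h2
    exact ⟨euler_partitionCoeff_aux m h3, _, h3⟩

/-- The Virasoro constraints. -/
theorem pderiv_partitionCoeff (m b : ℕ) :
    pderiv b (partitionCoeff (m + 1)) = virasoro b (partitionCoeff m) := by
  obtain ⟨h1, f', h2⟩ := partitionCoeff_aux m
  exact pderiv_partitionCoeff_aux m h1 h2 b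

theorem euler_partitionCoeff (m : ℕ) :
    shiftDer 1 (partitionCoeff m) = (3 * (m : ℂ)) • partitionCoeff m :=
  (partitionCoeff_aux m).1

/-! ### Power series with polynomial coefficients -/

/-- The uniqueness of the solution of a linear differential equation for power series. -/
theorem powerSeries_eq_zero_of_derivative {A : Type*} [CommRing A] [Algebra ℚ A]
    {Y B : PowerSeries A} (h : PowerSeries.derivative A Y = Y * B)
    (h0 : PowerSeries.constantCoeff Y = 0) : Y = 0 := by
  ext n
  induction n using Nat.strong_induction_on with
  | _ n ih =>
    rcases n with _ | n
    · simpa using h0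
    · have h1 := congrArg (PowerSeries.coeff n) h
      rw [PowerSeries.coeff_derivative, PowerSeries.coeff_mul, Finset.sum_eq_zero] at h1
      · have h2 : IsUnit ((n : A) + 1) := by
          have h3 : IsUnit ((n : ℚ) + 1) := (Nat.cast_add_one_ne_zero n).isUnit
          have h4 := h3.map (algebraMap ℚ A)
          simpa using h4
        rw [map_zero]
        exact (h2.mul_left_eq_zero).1 h1
      · rintro ⟨i, j⟩ hij
        have := Finset.HasAntidiagonal.mem_antidiagonal.1 hij
        rw [ih i (by simp at this; omega), map_zero, zero_mul]

/-- A derivation, applied to the coefficients of a power series. -/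
def mapDer (D : Derivation ℂ (MvPolynomial ℕ ℂ) (MvPolynomial ℕ ℂ))
    (φ : PowerSeries (MvPolynomial ℕ ℂ)) : PowerSeries (MvPolynomial ℕ ℂ) :=
  PowerSeries.mk fun m => D (PowerSeries.coeff m φ)

section MapDer

variable (D : Derivation ℂ (MvPolynomial ℕ ℂ) (MvPolynomial ℕ ℂ))

@[simp]
theorem coeff_mapDer (φ : PowerSeries (MvPolynomial ℕ ℂ)) (m : ℕ) :
    PowerSeries.coeff m (mapDer D φ) = D (PowerSeries.coeff m φ) := PowerSeries.coeff_mk _ _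

theorem mapDer_mul (φ ψ : PowerSeries (MvPolynomial ℕ ℂ)) :
    mapDer D (φ * ψ) = φ * mapDer D ψ + mapDer D φ * ψ := by
  ext1 m
  simp only [coeff_mapDer, PowerSeries.coeff_mul, map_add, map_sum, Derivation.leibniz,
    smul_eq_mul, Finset.sum_add_distrib]
  congr 1
  exact Finset.sum_congr rfl fun _ _ => mul_comm _ _

theorem derivative_mapDer (φ : PowerSeries (MvPolynomial ℕ ℂ)) :
    PowerSeries.derivative _ (mapDer D φ) = mapDer D (PowerSeries.derivative _ φ) := by
  ext1 m
  rw [PowerSeries.coeff_derivative, coeff_mapDer, coeff_mapDer, PowerSeries.coeff_derivative,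
    Derivation.leibniz, ← Nat.cast_succ, Derivation.map_natCast, smul_zero, zero_add, smul_eq_mul,
    mul_comm]

/-- The partition function of the Airy curve. -/
def partitionSeries : PowerSeries (MvPolynomial ℕ ℂ) := PowerSeries.mk partitionCoeff

theorem constantCoeff_partitionSeries : PowerSeries.constantCoeff partitionSeries = 1 := by
  rw [← PowerSeries.coeff_zero_eq_constantCoeff_apply, partitionSeries, PowerSeries.coeff_mk,
    partitionCoeff]

/-- The inverse of the partition function. -/
def partitionInv : PowerSeries (MvPolynomial ℕ ℂ) := PowerSeries.invOfUnit partitionSeries 1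

theorem partitionSeries_mul_inv : partitionSeries * partitionInv = 1 :=
  PowerSeries.mul_invOfUnit _ _ constantCoeff_partitionSeries

/-- The coefficients of the logarithm of the partition function. -/
def freeEnergy : ℕ → MvPolynomial ℕ ℂ
  | 0 => 0
  | m + 1 => (1 / ((m : ℂ) + 1)) •
      PowerSeries.coeff m (PowerSeries.derivative _ partitionSeries * partitionInv)

/-- The logarithm of the partition function. -/
def freeEnergySeries : PowerSeries (MvPolynomial ℕ ℂ) := PowerSeries.mk freeEnergy

theorem derivative_partitionSeries : PowerSeries.derivative _ partitionSeries =
    partitionSeries * PowerSeries.derivative _ freeEnergySeries := by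
  have h : PowerSeries.derivative _ freeEnergySeries =
      PowerSeries.derivative _ partitionSeries * partitionInv := by
    ext1 m
    rw [PowerSeries.coeff_derivative, freeEnergySeries, PowerSeries.coeff_mk, freeEnergy,
      smul_mul_assoc, mul_comm, smul_eq_C_mul, ← mul_assoc]
    have h1 : ((m : MvPolynomial ℕ ℂ) + 1) = C ((m : ℂ) + 1) := by simp
    have : (m : ℂ) + 1 ≠ 0 := Nat.cast_add_one_ne_zero m
    rw [h1, ← C_mul, one_div_mul_cancel this, C_1, one_mul]
  rw [h, mul_left_comm, partitionSeries_mul_inv, mul_one]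

/-- The logarithm is defined only through the derivative in the series variable. The difference $Y$
of the two sides satisfies $Y'=YF'$ and has no constant term, so the logarithmic derivative rule
holds in every other direction as well. -/
theorem mapDer_partitionSeries :
    mapDer D partitionSeries = partitionSeries * mapDer D freeEnergySeries := by
  rw [← sub_eq_zero]
  refine powerSeries_eq_zero_of_derivative
    (B := PowerSeries.derivative _ freeEnergySeries) ?_ ?_
  · rw [map_sub, derivative_mapDer, derivative_partitionSeries, mapDer_mul, Derivation.leibniz,
      derivative_mapDer, derivative_partitionSeries, smul_eq_mul, smul_eq_mul]
    ring
  · rw [map_sub, map_mul, constantCoeff_partitionSeries,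
      ← PowerSeries.coeff_zero_eq_constantCoeff_apply,
      ← PowerSeries.coeff_zero_eq_constantCoeff_apply, coeff_mapDer, coeff_mapDer,
      partitionSeries, freeEnergySeries, PowerSeries.coeff_mk, PowerSeries.coeff_mk,
      partitionCoeff, freeEnergy]
    simp

end MapDer

/-- On the partition series the Euler derivation acts as three times the degree operator in the
series variable. Both are derivations, so dividing by the series transfers this to the logarithm. -/
theorem euler_freeEnergy (m : ℕ) : shiftDer 1 (freeEnergy m) = (3 * (m : ℂ)) • freeEnergy m := by
  have h1 : mapDer (shiftDer 1) partitionSeries =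
      PowerSeries.C (3 : MvPolynomial ℕ ℂ) *
        (PowerSeries.X * PowerSeries.derivative _ partitionSeries) := by
    ext1 m
    rw [coeff_mapDer, PowerSeries.coeff_C_mul, partitionSeries, PowerSeries.coeff_mk,
      euler_partitionCoeff]
    rcases m with _ | m
    · simp
    · rw [PowerSeries.coeff_succ_X_mul, PowerSeries.coeff_derivative, PowerSeries.coeff_mk,
        smul_eq_C_mul, C_mul, show (C 3 : MvPolynomial ℕ ℂ) = 3 from map_ofNat C 3]
      simp
      ring
  have h2 := mapDer_partitionSeries (shiftDer 1)
  rw [h1, derivative_partitionSeries] at h2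
  have h3 : mapDer (shiftDer 1) freeEnergySeries = PowerSeries.C (3 : MvPolynomial ℕ ℂ) *
        (PowerSeries.X * PowerSeries.derivative _ freeEnergySeries) := by
    have := congrArg (partitionInv * ·) h2
    beta_reduce at this
    linear_combination (exp := 1) -this + (mapDer (shiftDer 1) freeEnergySeries -
      PowerSeries.C 3 * (PowerSeries.X * PowerSeries.derivative _ freeEnergySeries)) *
      (-partitionSeries_mul_inv)
  have h4 := congrArg (PowerSeries.coeff m) h3
  rw [coeff_mapDer, PowerSeries.coeff_C_mul, freeEnergySeries, PowerSeries.coeff_mk] at h4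
  rw [h4]
  rcases m with _ | m
  · simp
  · rw [PowerSeries.coeff_succ_X_mul, PowerSeries.coeff_derivative, PowerSeries.coeff_mk,
        smul_eq_C_mul, C_mul, show (C 3 : MvPolynomial ℕ ℂ) = 3 from map_ofNat C 3]
    simp
    ring

/-- The Virasoro constraints for the logarithm of the partition function. -/
theorem pderiv_freeEnergy (m a : ℕ) : pderiv a (freeEnergy (m + 1)) =
    secondOrder a (freeEnergy m) + (1 / 2 : ℂ) • (∑ i ∈ Finset.range (a - 1),
      ∑ x ∈ Finset.HasAntidiagonal.antidiagonal m, pderiv i (freeEnergy x.1) * pderiv (a - 2 - i) (freeEnergy x.2)) +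
      shiftDer a (freeEnergy m) + if m = 0 then potential a else 0 := by
  set Z := partitionSeries with hZ
  set F := freeEnergySeries with hF
  have hder : ∀ D, mapDer D Z = Z * mapDer D F := mapDer_partitionSeries
  have h1 : mapDer (pderiv a) Z = PowerSeries.X * (PowerSeries.C (C (1 / 2)) *
      (∑ i ∈ Finset.range (a - 1), mapDer (pderiv i) (mapDer (pderiv (a - 2 - i)) Z)) +
      mapDer (shiftDer a) Z + PowerSeries.C (potential a) * Z) := by
    ext1 m
    rw [coeff_mapDer]
    rcases m with _ | m
    · rw [PowerSeries.coeff_zero_X_mul, hZ, partitionSeries, PowerSeries.coeff_mk, partitionCoeff,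
        pderiv_one]
    · rw [PowerSeries.coeff_succ_X_mul, map_add, map_add, PowerSeries.coeff_C_mul,
        PowerSeries.coeff_C_mul, map_sum]
      simp only [coeff_mapDer]
      rw [hZ, partitionSeries, PowerSeries.coeff_mk, PowerSeries.coeff_mk, pderiv_partitionCoeff,
        virasoro_apply, secondOrder_apply, smul_eq_C_mul]
  -- Second derivatives of an exponential; the product of first derivatives is the quadratic term of
  -- the loop equation.
  have h2 : ∀ i j, mapDer (pderiv i) (mapDer (pderiv j) Z) =
      Z * (mapDer (pderiv i) (mapDer (pderiv j) F) +
        mapDer (pderiv i) F * mapDer (pderiv j) F) := by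
    intro i j
    rw [hder, mapDer_mul, hder]; ring
  simp only [h2, ← Finset.mul_sum] at h1
  simp only [hder] at h1
  have h3 : mapDer (pderiv a) F = PowerSeries.X * (PowerSeries.C (C (1 / 2)) *
      (∑ i ∈ Finset.range (a - 1), (mapDer (pderiv i) (mapDer (pderiv (a - 2 - i)) F) +
        mapDer (pderiv i) F * mapDer (pderiv (a - 2 - i)) F)) +
      mapDer (shiftDer a) F + PowerSeries.C (potential a)) := by
    have h4 := congrArg (partitionInv * ·) h1
    have h5 : ∀ φ, partitionInv * (Z * φ) = φ := fun φ => by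
      rw [← mul_assoc, mul_comm partitionInv, partitionSeries_mul_inv, one_mul]
    simp only [h5] at h4
    rw [h4]
    generalize (∑ i ∈ Finset.range (a - 1), (mapDer (pderiv i) (mapDer (pderiv (a - 2 - i)) F) +
        mapDer (pderiv i) F * mapDer (pderiv (a - 2 - i)) F)) = S
    rw [← h5 (PowerSeries.X * (PowerSeries.C (C (1 / 2)) * S +
      mapDer (shiftDer a) F + PowerSeries.C (potential a)))]
    ring
  have h4 := congrArg (PowerSeries.coeff (m + 1)) h3
  rw [coeff_mapDer, PowerSeries.coeff_succ_X_mul, map_add, map_add, PowerSeries.coeff_C_mul,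
    map_sum, PowerSeries.coeff_C] at h4
  simp only [map_add, coeff_mapDer, PowerSeries.coeff_mul, hF, freeEnergySeries,
    PowerSeries.coeff_mk, Finset.sum_add_distrib, mul_add, ← smul_eq_C_mul] at h4
  rw [h4, secondOrder_apply]

/-! ### Generating functions of the Virasoro operators -/

/-- The loop insertion operator `∑ y ^ (k + 1) ∂ₖ`. -/
abbrev loopDer (y : ℂ) : Derivation ℂ (MvPolynomial ℕ ℂ) (MvPolynomial ℕ ℂ) :=
  constDer fun k => y ^ (k + 1)

/-- The generating function `∑ y ^ (a + 1) shiftDer a`. -/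
def loopShift (y : ℂ) : Derivation ℂ (MvPolynomial ℕ ℂ) (MvPolynomial ℕ ℂ) :=
  mkDerivation ℂ fun k => ∑ b ∈ Finset.range (k + 2), (y ^ (k + 2 - b) * (2 * (b : ℂ) + 1)) • X b

theorem loopShift_X (y : ℂ) (k : ℕ) : loopShift y (X k) =
    ∑ b ∈ Finset.range (k + 2), (y ^ (k + 2 - b) * (2 * (b : ℂ) + 1)) • X b :=
  mkDerivation_X _ _ _

theorem sum_shiftDer (y : ℂ) {K A : ℕ} (hA : K + 1 ≤ A) {f : MvPolynomial ℕ ℂ}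
    (hf : f ∈ supported ℂ (Set.Iio K)) :
    ∑ a ∈ Finset.range A, y ^ (a + 1) • shiftDer a f = loopShift y f := by
  have h : loopShift y f = (∑ a ∈ Finset.range A, y ^ (a + 1) • shiftDer a :
        Derivation ℂ (MvPolynomial ℕ ℂ) (MvPolynomial ℕ ℂ)) f := by
    refine derivation_eqOn_supported (fun k hk => ?_) hf
    have hk : k < K := hk
    simp only [Function.comp_apply]
    rw [loopShift_X, sum_derivation_apply, ← Finset.sum_subset
      (Finset.range_subset_range.2 (show k + 2 ≤ A by omega)), ← Finset.sum_range_reflect]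
    · refine Finset.sum_congr rfl fun a ha => ?_
      have := Finset.mem_range.1 ha
      rw [Derivation.smul_apply, shiftDer_X, if_pos (by omega), smul_smul,
        show k + 2 - 1 - a = k + 1 - a by omega, show k + 2 - (k + 1 - a) = a + 1 by omega]
    · intro a _ ha
      have : ¬ a < k + 2 := fun h => ha (Finset.mem_range.2 h)
      rw [Derivation.smul_apply, shiftDer_X, if_neg (by omega), smul_zero]
  rw [h, sum_derivation_apply]
  simp

/-- For $i+j=a-2$ the power $y^{a+1}$ factors as $y\cdot y^{i+1}y^{j+1}$, so the convolution splits
into two loop insertions. -/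
theorem sum_convolution {R : Type*} [AddCommGroup R] [Module ℂ R] (y : ℂ) {K A : ℕ}
    (hA : 2 * K + 2 ≤ A) (β : ℕ → ℕ → R) (hβ : ∀ i j, K ≤ i ∨ K ≤ j → β i j = 0) :
    ∑ a ∈ Finset.range A, y ^ (a + 1) • ∑ i ∈ Finset.range (a - 1), β i (a - 2 - i) =
      y • ∑ i ∈ Finset.range K, ∑ j ∈ Finset.range K, (y ^ (i + 1) * y ^ (j + 1)) • β i j := by
  simp only [Finset.smul_sum]
  rw [Finset.sum_sigma', ← Finset.sum_product']
  symm
  refine Finset.sum_of_injOn (fun x : ℕ × ℕ => (⟨x.1 + x.2 + 2, x.1⟩ : Σ _ : ℕ, ℕ)) ?_ ?_ ?_ ?_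
  · rintro ⟨i, j⟩ _ ⟨i', j'⟩ _ h
    simp only [Sigma.mk.injEq, heq_eq_eq] at h
    ext <;> simp <;> omega
  · rintro ⟨i, j⟩ h
    simp only [Finset.coe_product, Set.mem_prod, Finset.mem_coe, Finset.mem_range] at h
    simp only [Finset.coe_sigma, Set.mem_sigma_iff, Finset.mem_coe, Finset.mem_range]
    omega
  · rintro ⟨a, i⟩ h h'
    simp only [Finset.mem_sigma, Finset.mem_range] at h
    rw [hβ, smul_zero]
    by_contra hc
    push Not at hc
    refine h' ⟨(i, a - 2 - i), by simpa using hc, ?_⟩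
    simp only [Sigma.mk.injEq, heq_eq_eq, and_true]
    omega
  · rintro ⟨i, j⟩ _
    simp only [smul_smul, show i + j + 2 - 2 - i = j by omega]
    congr 1
    ring

theorem sum_pderiv_mul_pderiv (y : ℂ) {K A : ℕ} (hA : 2 * K + 2 ≤ A) {f g : MvPolynomial ℕ ℂ}
    (hf : f ∈ supported ℂ (Set.Iio K)) (hg : g ∈ supported ℂ (Set.Iio K)) :
    ∑ a ∈ Finset.range A, y ^ (a + 1) •
      ∑ i ∈ Finset.range (a - 1), pderiv i f * pderiv (a - 2 - i) g =
      y • (loopDer y f * loopDer y g) := by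
  rw [sum_convolution y hA fun i j => pderiv i f * pderiv j g]
  · rw [constDer_eq_sum _ hf, constDer_eq_sum _ hg, Finset.sum_mul_sum]
    simp only [smul_mul_smul_comm]
  · rintro i j (h | h)
    · simp only [pderiv_eq_zero_of_mem_supported h hf, zero_mul]
    · simp only [pderiv_eq_zero_of_mem_supported h hg, mul_zero]

theorem sum_secondOrder (y : ℂ) {K A : ℕ} (hA : 2 * K + 2 ≤ A) {f : MvPolynomial ℕ ℂ}
    (hf : f ∈ supported ℂ (Set.Iio K)) :
    ∑ a ∈ Finset.range A, y ^ (a + 1) • secondOrder a f =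
      (y / 2) • loopDer y (loopDer y f) := by
  simp only [secondOrder_apply, smul_comm _ (1 / 2 : ℂ)]
  rw [← Finset.smul_sum, sum_convolution y hA fun i j => pderiv i (pderiv j f)]
  · rw [constDer_eq_sum _ (constDer_mem_supported _ hf), constDer_eq_sum _ hf, smul_smul,
      one_div_mul_eq_div]
    simp only [map_sum, Derivation.map_smul, Finset.smul_sum, smul_smul]
  · rintro i j (h | h)
    · simp only [pderiv_comm i, pderiv_eq_zero_of_mem_supported h hf, map_zero]
    · simp only [pderiv_eq_zero_of_mem_supported h hf, map_zero]

/-- The generating function of the potentials. -/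
def loopPotential (y : ℂ) : MvPolynomial ℕ ℂ := (y / 2) • X 0 ^ 2 + C (y ^ 2 / 8)

theorem sum_potential (y : ℂ) {A : ℕ} (hA : 2 ≤ A) :
    ∑ a ∈ Finset.range A, y ^ (a + 1) • potential a = loopPotential y := by
  rw [← Finset.sum_subset (Finset.range_subset_range.2 hA)]
  · rw [Finset.sum_range_succ, Finset.sum_range_one, loopPotential, potential, potential,
      if_pos rfl, if_neg one_ne_zero, if_pos rfl, smul_smul]
    congr 1
    · congr 1; ring
    · rw [smul_eq_C_mul, ← C_mul]; congr 1; ring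
  · intro a _ ha
    have : ¬ a < 2 := fun h => ha (Finset.mem_range.2 h)
    rw [potential, if_neg (by omega), if_neg (by omega), smul_zero]

theorem loopDer_partitionCoeff (y : ℂ) (m : ℕ) : loopDer y (partitionCoeff (m + 1)) =
    (y / 2) • loopDer y (loopDer y (partitionCoeff m)) + loopShift y (partitionCoeff m) +
      loopPotential y * partitionCoeff m := by
  have hm := partitionCoeff_mem_supported m
  have hm' := partitionCoeff_mem_supported (m + 1)
  rw [constDer_eq_sum _ hm', show varBound (m + 1) = 2 * varBound m + 2 from rfl]
  simp only [pderiv_partitionCoeff, virasoro_apply, smul_add, Finset.sum_add_distrib,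
    ← smul_mul_assoc]
  rw [← Finset.sum_mul, sum_secondOrder y le_rfl hm, sum_shiftDer y (by omega) hm,
    sum_potential y (by omega)]

/-- The loop equation, to be compared with the residue recursion at $y=z_0^{-2}$. -/
theorem loopDer_freeEnergy (y : ℂ) (m : ℕ) : loopDer y (freeEnergy (m + 1)) =
    (y / 2) • (loopDer y (loopDer y (freeEnergy m)) +
      ∑ x ∈ Finset.HasAntidiagonal.antidiagonal m, loopDer y (freeEnergy x.1) * loopDer y (freeEnergy x.2)) +
      loopShift y (freeEnergy m) + if m = 0 then loopPotential y else 0 := by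
  choose K hK using fun k => exists_mem_supported (freeEnergy k)
  -- A common bound for the variables of all coefficients involved makes every sum over `a` below `2
  -- * L + 2` complete.
  obtain ⟨L, hL⟩ := ((Finset.range (m + 2)).image K).bddAbove
  have hL' : ∀ k ≤ m + 1, freeEnergy k ∈ supported ℂ (Set.Iio L) := fun k hk =>
    supportedIio_mono (hL (Finset.mem_coe.2 (Finset.mem_image_of_mem _
      (Finset.mem_range.2 (by omega))))) (hK k)
  have hx : ∀ x ∈ Finset.HasAntidiagonal.antidiagonal m, x.1 ≤ m ∧ x.2 ≤ m := fun x hx => by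
    have := Finset.HasAntidiagonal.mem_antidiagonal.1 hx
    omega
  rw [constDer_eq_sum _ (supportedIio_mono (show L ≤ 2 * L + 2 by omega) (hL' _ le_rfl))]
  simp only [pderiv_freeEnergy, smul_add, Finset.sum_add_distrib]
  rw [sum_secondOrder y le_rfl (hL' m (by omega)), sum_shiftDer y (by omega) (hL' m (by omega))]
  congr 1
  · have h1 : ∑ a ∈ Finset.range (2 * L + 2), y ^ (a + 1) • ∑ i ∈ Finset.range (a - 1),
        ∑ x ∈ Finset.HasAntidiagonal.antidiagonal m,
          pderiv i (freeEnergy x.1) * pderiv (a - 2 - i) (freeEnergy x.2) =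
        y • ∑ x ∈ Finset.HasAntidiagonal.antidiagonal m,
          loopDer y (freeEnergy x.1) * loopDer y (freeEnergy x.2) := by
      rw [Finset.smul_sum, ← Finset.sum_congr rfl fun x hxm => sum_pderiv_mul_pderiv y
        (le_refl (2 * L + 2)) (hL' x.1 (by have := hx x hxm; omega))
        (hL' x.2 (by have := hx x hxm; omega)), Finset.sum_comm]
      refine Finset.sum_congr rfl fun a _ => ?_
      rw [← Finset.smul_sum, Finset.sum_comm]
    simp only [smul_comm _ (1 / 2 : ℂ)]
    rw [← Finset.smul_sum, h1, smul_smul, one_div_mul_eq_div]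
  · split_ifs
    · exact sum_potential y (by omega)
    · simp

/-! ### Iterated derivations -/

/-- Commutation allows iterated derivations to be indexed by multisets, so the symmetry of the
correlators in their points is built in. -/
instance : LeftCommutative fun (c : ℕ → ℂ) (L : MvPolynomial ℕ ℂ →ₗ[ℂ] MvPolynomial ℕ ℂ) =>
    (constDer c).toLinearMap ∘ₗ L :=
  ⟨fun c d L => LinearMap.ext fun f => constDer_comm c d (L f)⟩

/-- The composition of derivations with constant coefficients. -/
def multiDer (M : Multiset (ℕ → ℂ)) : MvPolynomial ℕ ℂ →ₗ[ℂ] MvPolynomial ℕ ℂ :=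
  M.foldr (fun c L => (constDer c).toLinearMap ∘ₗ L) LinearMap.id

@[simp]
theorem multiDer_zero (f : MvPolynomial ℕ ℂ) : multiDer 0 f = f := rfl

theorem multiDer_cons' (c : ℕ → ℂ) (M : Multiset (ℕ → ℂ)) (f : MvPolynomial ℕ ℂ) :
    multiDer (c ::ₘ M) f = constDer c (multiDer M f) := by
  rw [multiDer, Multiset.foldr_cons]; rfl

theorem constDer_multiDer (c : ℕ → ℂ) (M : Multiset (ℕ → ℂ)) (f : MvPolynomial ℕ ℂ) :
    constDer c (multiDer M f) = multiDer M (constDer c f) := by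
  induction M using Multiset.induction_on with
  | empty => rfl
  | cons d M ih => rw [multiDer_cons', multiDer_cons', constDer_comm, ih]

theorem multiDer_cons (c : ℕ → ℂ) (M : Multiset (ℕ → ℂ)) (f : MvPolynomial ℕ ℂ) :
    multiDer (c ::ₘ M) f = multiDer M (constDer c f) := by
  rw [multiDer_cons', constDer_multiDer]

theorem multiDer_insert {ι : Type*} [DecidableEq ι] {A : Finset ι} {j : ι} (hj : j ∉ A)
    (c : ι → ℕ → ℂ) (f : MvPolynomial ℕ ℂ) :
    multiDer ((insert j A).val.map c) f = multiDer (A.val.map c) (constDer (c j) f) := by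
  rw [Finset.insert_val_of_notMem hj, Multiset.map_cons, multiDer_cons]

/-- The Leibniz rule for iterated derivations. -/
theorem multiDer_mul {ι : Type*} [DecidableEq ι] (A : Finset ι) (c : ι → ℕ → ℂ)
    (f g : MvPolynomial ℕ ℂ) :
    multiDer (A.val.map c) (f * g) =
      ∑ B ∈ A.powerset, multiDer (B.val.map c) f * multiDer ((A \ B).val.map c) g := by
  induction A using Finset.induction_on generalizing f g with
  | empty => simp
  | insert j A hj ih =>
    rw [multiDer_insert hj, Derivation.leibniz, map_add, smul_eq_mul, smul_eq_mul, ih, mul_comm g,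
      ih, Finset.sum_powerset_insert hj]
    congr 1
    · refine Finset.sum_congr rfl fun B hB => ?_
      have hjB : j ∉ B := fun h => hj (Finset.mem_powerset.1 hB h)
      rw [Finset.insert_sdiff_of_notMem _ hjB, multiDer_insert (by simp [hj])]
    · refine Finset.sum_congr rfl fun B hB => ?_
      have hjB : j ∉ B := fun h => hj (Finset.mem_powerset.1 hB h)
      rw [Finset.insert_sdiff_insert, multiDer_insert hjB, Finset.sdiff_insert_of_notMem hj]

theorem constDer_loopShift (c : ℕ → ℂ) (y : ℂ) (f : MvPolynomial ℕ ℂ) :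
    constDer c (loopShift y f) = loopShift y (constDer c f) +
      constDer (fun k => ∑ b ∈ Finset.range (k + 2), y ^ (k + 2 - b) * (2 * (b : ℂ) + 1) * c b) f := by
  refine derivation_comp_eq (fun k => ?_) f
  rw [loopShift_X]
  simp [smul_eq_C_mul]

theorem constantCoeff_shiftDer (a : ℕ) (f : MvPolynomial ℕ ℂ) :
    constantCoeff (shiftDer a f) = 0 := by
  induction f using MvPolynomial.induction_on with
  | C r => simp
  | add f g hf hg => rw [map_add, map_add, hf, hg, add_zero]
  | mul_X f k hf =>
    rw [Derivation.leibniz, map_add, smul_eq_mul, smul_eq_mul, map_mul, map_mul, hf, shiftDer_X]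
    split_ifs <;> simp

theorem constantCoeff_loopShift (y : ℂ) (f : MvPolynomial ℕ ℂ) :
    constantCoeff (loopShift y f) = 0 := by
  obtain ⟨K, hK⟩ := exists_mem_supported f
  rw [← sum_shiftDer y le_rfl hK, map_sum]
  refine Finset.sum_eq_zero fun a _ => ?_
  rw [smul_eq_C_mul, map_mul, constantCoeff_shiftDer, mul_zero]

/-- `loopShift y` has linear coefficients: its commutator with a constant derivation is again
constant, and it vanishes at the origin. Hence exactly one derivation must hit it. -/
theorem multiDer_loopShift {ι : Type*} [DecidableEq ι] (A : Finset ι) (c : ι → ℕ → ℂ) (y : ℂ)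
    (f : MvPolynomial ℕ ℂ) :
    constantCoeff (multiDer (A.val.map c) (loopShift y f)) =
      ∑ i ∈ A, constantCoeff (multiDer ((A.erase i).val.map c) (constDer (fun k =>
        ∑ b ∈ Finset.range (k + 2), y ^ (k + 2 - b) * (2 * (b : ℂ) + 1) * c i b) f)) := by
  induction A using Finset.induction_on generalizing f with
  | empty => simpa using constantCoeff_loopShift y f
  | insert j A hj ih =>
    rw [multiDer_insert hj, constDer_loopShift, map_add, map_add, ih, Finset.sum_insert hj,
      Finset.erase_insert hj, add_comm]
    congr 1
    refine Finset.sum_congr rfl fun i hi => ?_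
    have hij : j ≠ i := fun h => hj (h ▸ hi)
    rw [Finset.erase_insert_of_ne hij, multiDer_insert (by simp [hj]), constDer_comm]

/-! ### The genus expansion -/

/-- The Taylor coefficients of `f` of degree `n` vanish unless `N = 2 g + n` for some `g ≥ 0`. -/
def HasGenus (N : ℤ) (f : MvPolynomial ℕ ℂ) : Prop :=
  ∀ M : Multiset (ℕ → ℂ), (¬∃ g : ℕ, N = 2 * g + M.card) → constantCoeff (multiDer M f) = 0

namespace HasGenus

variable {N N' : ℤ} {f g : MvPolynomial ℕ ℂ}

theorem zero (N : ℤ) : HasGenus N 0 := fun M _ => by simp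

theorem add (hf : HasGenus N f) (hg : HasGenus N g) : HasGenus N (f + g) := fun M h => by
  rw [map_add, map_add, hf M h, hg M h, add_zero]

theorem smul (hf : HasGenus N f) (r : ℂ) : HasGenus N (r • f) := fun M h => by
  rw [map_smul, smul_eq_C_mul, map_mul, hf M h, mul_zero]

theorem sum {ι : Type*} {s : Finset ι} {f : ι → MvPolynomial ℕ ℂ}
    (h : ∀ i ∈ s, HasGenus N (f i)) : HasGenus N (∑ i ∈ s, f i) := fun M hM => by
  rw [map_sum, map_sum]
  exact Finset.sum_eq_zero fun i hi => h i hi M hM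

theorem constDer (hf : HasGenus N f) (c : ℕ → ℂ) : HasGenus (N - 1) (constDer c f) :=
  fun M h => by
    rw [← multiDer_cons]
    refine hf _ fun ⟨g, hg⟩ => h ⟨g, ?_⟩
    rw [Multiset.card_cons] at hg
    push_cast at hg
    linarith

theorem pderiv (hf : HasGenus N f) (i : ℕ) : HasGenus (N - 1) (pderiv i f) := by
  rw [pderiv_eq_constDer]; exact hf.constDer _

/-- Adding 2 raises the genus by one. -/
theorem add_two (hf : HasGenus N f) : HasGenus (N + 2) f := fun M h =>
  hf M fun ⟨g, hg⟩ => h ⟨g + 1, by push_cast; linarith⟩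

theorem mul (hf : HasGenus N f) (hg : HasGenus N' g) : HasGenus (N + N') (f * g) := by
  intro M
  induction M using Multiset.induction_on generalizing N N' f g with
  | empty =>
    intro h
    rw [multiDer_zero, map_mul]
    by_cases h1 : ∃ k : ℕ, N = 2 * k + (Multiset.card (0 : Multiset (ℕ → ℂ)) : ℕ)
    · by_cases h2 : ∃ k : ℕ, N' = 2 * k + (Multiset.card (0 : Multiset (ℕ → ℂ)) : ℕ)
      · obtain ⟨k, hk⟩ := h1
        obtain ⟨k', hk'⟩ := h2
        refine absurd ⟨k + k', ?_⟩ h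
        simp at hk hk'
        simp [hk, hk']
        ring
      · have := hg 0 h2
        rw [multiDer_zero] at this
        rw [this, mul_zero]
    · have := hf 0 h1
      rw [multiDer_zero] at this
      rw [this, zero_mul]
  | cons c M ih =>
    intro h
    have h' : ∀ K : ℤ, K = N + N' - 1 → ¬∃ k : ℕ, K = 2 * k + (Multiset.card M : ℕ) := by
      rintro _ rfl ⟨k, hk⟩
      refine h ⟨k, ?_⟩
      rw [Multiset.card_cons]
      push_cast
      linarith
    rw [multiDer_cons, Derivation.leibniz, map_add, map_add, smul_eq_mul, smul_eq_mul,
      ih hf (hg.constDer c) (h' _ (by ring)), ih hg (hf.constDer c) (h' _ (by ring)), add_zero]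

theorem C (r : ℂ) : HasGenus 0 (C r) := by
  intro M h
  rcases M.empty_or_exists_mem with rfl | ⟨c, hc⟩
  · exact absurd ⟨0, by simp⟩ h
  · obtain ⟨M, rfl⟩ := Multiset.exists_cons_of_mem hc
    rw [multiDer_cons, derivation_C, map_zero, map_zero]

theorem X (k : ℕ) : HasGenus 1 (X k) := by
  intro M h
  rcases M.empty_or_exists_mem with rfl | ⟨c, hc⟩
  · simp
  · obtain ⟨M, rfl⟩ := Multiset.exists_cons_of_mem hc
    rw [multiDer_cons, constDer_X]
    refine C _ M fun ⟨g, hg⟩ => h ⟨g, ?_⟩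
    rw [Multiset.card_cons]
    push_cast
    linarith

theorem shiftDer (hf : HasGenus N f) (a : ℕ) : HasGenus N (shiftDer a f) := by
  intro M
  induction M using Multiset.induction_on generalizing N f with
  | empty => intro _; exact constantCoeff_shiftDer a f
  | cons c M ih =>
    intro h
    have h' : ¬∃ g : ℕ, N - 1 = 2 * g + M.card := fun ⟨g, hg⟩ => h ⟨g, by
      rw [Multiset.card_cons]; push_cast; linarith⟩
    rw [multiDer_cons, constDer_shiftDer, map_add, map_add, ih (hf.constDer c) h',
      hf.constDer _ M h', add_zero]

theorem of_pderiv (h0 : constantCoeff f = 0)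
    (h : ∀ a, HasGenus (N - 1) (MvPolynomial.pderiv a f)) : HasGenus N f := by
  intro M hM
  rcases M.empty_or_exists_mem with rfl | ⟨c, hc⟩
  · exact h0
  · obtain ⟨M, rfl⟩ := Multiset.exists_cons_of_mem hc
    obtain ⟨K, hK⟩ := exists_mem_supported f
    rw [multiDer_cons, constDer_eq_sum c hK]
    refine HasGenus.sum (N := N - 1) (fun a _ => (h a).smul _) M fun ⟨g, hg⟩ => hM ⟨g, ?_⟩
    rw [Multiset.card_cons]
    push_cast
    linarith

theorem secondOrder (hf : HasGenus N f) (a : ℕ) : HasGenus (N - 2) (secondOrder a f) := by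
  rw [secondOrder_apply]
  refine HasGenus.smul (HasGenus.sum fun i _ => ?_) _
  have := (hf.pderiv (a - 2 - i)).pderiv i
  rwa [show N - 1 - 1 = N - 2 by ring] at this

theorem potential (a : ℕ) : HasGenus 2 (potential a) := by
  rw [Airy.potential]
  split_ifs
  · rw [pow_two]; exact ((X 0).mul (X 0)).smul _
  · exact (C _).add_two
  · exact zero _

end HasGenus

/-- A homogeneous polynomial of nonzero weight has no constant term. -/
theorem constantCoeff_freeEnergy (m : ℕ) : constantCoeff (freeEnergy m) = 0 := by
  rcases m with _ | m
  · simp [freeEnergy]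
  · have h := congrArg constantCoeff (euler_freeEnergy (m + 1))
    rw [constantCoeff_shiftDer, smul_eq_C_mul, map_mul, constantCoeff_C] at h
    have h1 : 3 * ((m + 1 : ℕ) : ℂ) ≠ 0 := by
      have := Nat.cast_add_one_ne_zero (R := ℂ) m
      push_cast
      simpa using this
    exact (mul_eq_zero.1 h.symm).resolve_left h1

/-- Every term of the constraint respects the grading. Second derivatives lose 2, which one
additional genus restores, and a product of first derivatives adds genera. -/
theorem hasGenus_freeEnergy (m : ℕ) : HasGenus (m + 2) (freeEnergy m) := by
  induction m using Nat.strong_induction_on with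
  | _ m ih =>
    refine HasGenus.of_pderiv (constantCoeff_freeEnergy m) fun a => ?_
    rcases m with _ | m
    · simpa [freeEnergy] using HasGenus.zero _
    · have hm := ih m (Nat.lt_succ_self m)
      rw [pderiv_freeEnergy, show ((m + 1 : ℕ) : ℤ) + 2 - 1 = m + 2 by push_cast; ring]
      refine HasGenus.add (HasGenus.add (HasGenus.add ?_ ?_) (hm.shiftDer a)) ?_
      · have := (hm.secondOrder a).add_two
        rwa [show (m : ℤ) + 2 - 2 + 2 = m + 2 by ring] at this
      · refine HasGenus.smul (HasGenus.sum fun i _ => HasGenus.sum fun x hx => ?_) _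
        have hx := Finset.HasAntidiagonal.mem_antidiagonal.1 hx
        have := ((ih x.1 (by omega)).pderiv i).mul ((ih x.2 (by omega)).pderiv (a - 2 - i))
        rwa [show (x.1 : ℤ) + 2 - 1 + (x.2 + 2 - 1) = m + 2 by rw [← hx]; push_cast; ring] at this
      · split_ifs with h
        · subst h; exact HasGenus.potential a
        · exact HasGenus.zero _

/-! ### Computation of residues -/

/-- On all small circles around `0`, the function `f` is continuous and its integral is `2 π i a`. -/
def IsResidue (f : ℂ → ℂ) (a : ℂ) : Prop :=
  ∀ᶠ r : ℝ in 𝓝[>] 0, ContinuousOn f (Metric.sphere 0 r) ∧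
    (2 * Real.pi * Complex.I)⁻¹ * (∮ z in C(0, r), f z) = a

namespace IsResidue

variable {f g : ℂ → ℂ} {a b : ℂ}

theorem hasResidue (h : IsResidue f a) : HasResidue f 0 a :=
  tendsto_const_nhds.congr' (h.mono fun _ hr => hr.2.symm)

theorem add (hf : IsResidue f a) (hg : IsResidue g b) : IsResidue (fun z => f z + g z) (a + b) := by
  filter_upwards [hf, hg, self_mem_nhdsWithin] with r hf hg hr
  refine ⟨hf.1.add hg.1, ?_⟩
  rw [circleIntegral.integral_add (hf.1.circleIntegrable (le_of_lt hr))
    (hg.1.circleIntegrable (le_of_lt hr)), mul_add, hf.2, hg.2]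

theorem const_mul (hf : IsResidue f a) (c : ℂ) : IsResidue (fun z => c * f z) (c * a) := by
  filter_upwards [hf] with r hf
  refine ⟨continuousOn_const.mul hf.1, ?_⟩
  rw [circleIntegral.integral_const_mul, mul_left_comm, hf.2]

theorem zero : IsResidue (fun _ => 0) 0 := by
  refine Filter.Eventually.of_forall fun r => ⟨continuousOn_const, ?_⟩
  simp [circleIntegral]

theorem sum {ι : Type*} {s : Finset ι} {f : ι → ℂ → ℂ} {a : ι → ℂ}
    (h : ∀ i ∈ s, IsResidue (f i) (a i)) : IsResidue (fun z => ∑ i ∈ s, f i z) (∑ i ∈ s, a i) := by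
  classical
  induction s using Finset.induction_on with
  | empty => simpa using zero
  | insert i s hi ih =>
    simp only [Finset.sum_insert hi]
    exact (h i (by simp)).add (ih fun j hj => h j (by simp [hj]))

theorem congr' (hf : IsResidue f a) (h : ∀ᶠ z in 𝓝[≠] 0, g z = f z) : IsResidue g a := by
  obtain ⟨ε, hε, h⟩ := Metric.eventually_nhds_iff.1 (eventually_nhdsWithin_iff.1 h)
  filter_upwards [hf, Ioo_mem_nhdsGT hε] with r hf hr
  have heq : Set.EqOn g f (Metric.sphere 0 r) := fun z hz => by
    refine h ((Metric.mem_sphere.1 hz).trans_lt hr.2) fun h0 => ?_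
    rw [h0] at hz
    simp at hz
    exact absurd hz.symm (ne_of_gt hr.1)
  refine ⟨hf.1.congr heq, ?_⟩
  rw [circleIntegral.integral_congr (le_of_lt hr.1) heq, hf.2]

theorem congr (hf : IsResidue f a) (h : ∀ z ≠ 0, g z = f z) : IsResidue g a :=
  hf.congr' (eventually_mem_nhdsWithin.mono h)

end IsResidue

theorem isResidue_of_hasFPowerSeriesAt {h : ℂ → ℂ} {P : FormalMultilinearSeries ℂ ℂ ℂ}
    (hP : HasFPowerSeriesAt h P 0) (n : ℕ) :
    IsResidue (fun z => (z ^ (n + 1))⁻¹ * h z) (P.coeff n) := by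
  obtain ⟨ε, hε, hd⟩ := Metric.eventually_nhds_iff.1 hP.eventually_differentiableAt
  filter_upwards [Ioo_mem_nhdsGT hε] with r hr
  have hdiff : ∀ z ∈ Metric.closedBall (0 : ℂ) r, DifferentiableAt ℂ h z := fun z hz =>
    hd (lt_of_le_of_lt hz hr.2)
  constructor
  · intro z hz
    have hz0 : z ≠ 0 := fun h0 => by
      rw [h0] at hz
      simp at hz
      exact absurd hz.symm (ne_of_gt hr.1)
    have h1 := (hdiff z (Metric.sphere_subset_closedBall hz)).continuousAt
    exact (((continuousAt_id.pow (n + 1)).inv₀ (pow_ne_zero _ hz0)).mul h1).continuousWithinAt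
  · lift r to NNReal using hr.1.le
    have h2 : DifferentiableOn ℂ h (Metric.closedBall 0 r) := fun z hz =>
      (hdiff z hz).differentiableWithinAt
    have h3 := h2.hasFPowerSeriesOnBall (by exact_mod_cast hr.1)
    rw [hP.eq_formalMultilinearSeries h3.hasFPowerSeriesAt]
    have h4 := cauchyPowerSeries_apply h 0 r n 1
    have h5 : (cauchyPowerSeries h 0 r).coeff n = (cauchyPowerSeries h 0 r n) fun _ => 1 := rfl
    rw [h5, h4, smul_eq_mul]
    congr 2
    funext z
    simp only [sub_zero, smul_eq_mul]
    rw [one_div, inv_pow, pow_succ, mul_inv, mul_assoc]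

theorem isResidue_inv_mul {h : ℂ → ℂ} (hh : AnalyticAt ℂ h 0) :
    IsResidue (fun z => z⁻¹ * h z) (h 0) := by
  obtain ⟨P, hP⟩ := hh
  have h1 := isResidue_of_hasFPowerSeriesAt hP 0
  rw [show P.coeff 0 = h 0 from hP.coeff_zero _] at h1
  simpa using h1

/-- The function `H` is the sum of the power series with coefficients `P` near `0`. -/
def HasTaylor (H : ℂ → ℂ) (P : ℕ → ℂ) : Prop :=
  ∀ᶠ w in 𝓝 (0 : ℂ), HasSum (fun n => P n * w ^ n) (H w)

theorem HasTaylor.mul {H G : ℂ → ℂ} {P Q : ℕ → ℂ} (hH : HasTaylor H P) (hG : HasTaylor G Q) :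
    HasTaylor (fun w => H w * G w)
      fun n => ∑ x ∈ Finset.HasAntidiagonal.antidiagonal n, P x.1 * Q x.2 := by
  filter_upwards [hH, hG] with w hH hG
  have h1 := summable_norm_iff.2 hH.summable
  have h2 := summable_norm_iff.2 hG.summable
  have h3 := tsum_mul_tsum_eq_tsum_sum_antidiagonal_of_summable_norm h1 h2
  have h4 := (summable_norm_sum_mul_antidiagonal_of_summable_norm h1 h2).of_norm.hasSum
  rw [← h3, hH.tsum_eq, hG.tsum_eq] at h4
  convert! h4 using 2 with n
  rw [Finset.sum_mul]
  refine Finset.sum_congr rfl fun x hx => ?_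
  rw [← Finset.HasAntidiagonal.mem_antidiagonal.1 hx, pow_add]
  ring

/-- The kernel and all functions paired with it become functions of $w=z^2$ after symmetrization, so
residues in $z$ are Taylor coefficients in $w$. -/
theorem HasTaylor.isResidue {H : ℂ → ℂ} {P : ℕ → ℂ} (hH : HasTaylor H P) (k : ℕ) :
    IsResidue (fun z => z⁻¹ * ((z ^ 2)⁻¹ ^ k * H (z ^ 2))) (P k) := by
  have h1 : HasFPowerSeriesAt (fun z => H (z ^ 2))
      (FormalMultilinearSeries.ofScalars ℂ fun n => if Even n then P (n / 2) else 0) 0 := by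
    rw [hasFPowerSeriesAt_iff]
    have h2 : Filter.Tendsto (fun z : ℂ => z ^ 2) (𝓝 0) (𝓝 0) := by
      have : Continuous fun z : ℂ => z ^ 2 := by fun_prop
      simpa using this.tendsto 0
    filter_upwards [h2.eventually hH] with z hz
    simp only [zero_add, FormalMultilinearSeries.coeff_ofScalars, smul_eq_mul]
    have hinj : Function.Injective fun n : ℕ => 2 * n := fun a b h => by simpa using h
    rw [← hinj.hasSum_iff]
    · convert! hz using 2 with n
      simp only [Function.comp_apply, even_two_mul, if_true]
      rw [Nat.mul_div_cancel_left _ two_pos, pow_mul, mul_comm]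
    · intro n hn
      rw [if_neg, mul_zero]
      rintro ⟨m, rfl⟩
      exact hn ⟨m, by simp only; ring⟩
  have h2 := isResidue_of_hasFPowerSeriesAt h1 (2 * k)
  rw [FormalMultilinearSeries.coeff_ofScalars, if_pos (even_two_mul k),
    Nat.mul_div_cancel_left _ two_pos] at h2
  refine h2.congr fun z _ => ?_
  rw [pow_succ _ (2 * k), mul_inv, pow_mul, inv_pow]
  ring

theorem hasTaylor_inv_sub {a : ℂ} (ha : a ≠ 0) :
    HasTaylor (fun w => (a - w)⁻¹) fun n => a⁻¹ ^ (n + 1) := by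
  have h1 : ∀ᶠ w : ℂ in 𝓝 0, ‖w‖ < ‖a‖ := by
    have : Filter.Tendsto (fun w : ℂ => ‖w‖) (𝓝 0) (𝓝 0) := by
      simpa using (continuous_norm (E := ℂ)).tendsto 0
    exact this.eventually (gt_mem_nhds (norm_pos_iff.2 ha))
  filter_upwards [h1] with w hw
  have h2 : ‖a⁻¹ * w‖ < 1 := by
    rw [norm_mul, norm_inv, inv_mul_lt_one₀ (norm_pos_iff.2 ha)]
    exact hw
  have h3 := (hasSum_geometric_of_norm_lt_one h2).mul_left a⁻¹
  have h4 : a⁻¹ * (1 - a⁻¹ * w)⁻¹ = (a - w)⁻¹ := by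
    rw [← mul_inv, mul_sub, mul_one, mul_inv_cancel_left₀ ha]
  rw [h4] at h3
  convert! h3 using 2 with n
  rw [mul_pow, pow_succ]
  ring

theorem hasTaylor_bergman {a : ℂ} (ha : a ≠ 0) :
    HasTaylor (fun w => (a + w) * ((a - w) ^ 2)⁻¹) fun n => (2 * (n : ℂ) + 1) * a⁻¹ ^ (n + 1) := by
  have h1 := hasTaylor_inv_sub ha
  have h2 := h1.mul h1
  have h3 : ∀ᶠ w : ℂ in 𝓝 0, w ≠ a := isOpen_ne.mem_nhds ha.symm
  filter_upwards [h1, h2, h3] with w h1 h2 h3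
  have h3 : a - w ≠ 0 := sub_ne_zero.2 h3.symm
  have h4 := (h2.mul_left (2 * a)).sub h1
  -- Partial fractions reduce the expansion to the geometric series and its square.
  have h5 : 2 * a * ((a - w)⁻¹ * (a - w)⁻¹) - (a - w)⁻¹ = (a + w) * ((a - w) ^ 2)⁻¹ := by
    field_simp
    ring
  rw [h5] at h4
  convert! h4 using 2 with n
  rw [Finset.sum_congr rfl (g := fun _ => a⁻¹ ^ (n + 2))]
  · rw [Finset.sum_const, Finset.Nat.card_antidiagonal, nsmul_eq_mul, pow_succ _ (n + 1)]
    have : a * a⁻¹ = 1 := mul_inv_cancel₀ ha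
    push_cast
    linear_combination (-2 * ((n : ℂ) + 1) * a⁻¹ ^ (n + 1) * w ^ n) * this
  · intro x hx
    rw [← Finset.HasAntidiagonal.mem_antidiagonal.1 hx, ← pow_add]
    congr 1
    ring

/-- Residues against the recursion kernel, for a Laurent polynomial in `z ^ 2`. -/
theorem isResidue_kernel {z₀ : ℂ} (h : z₀ ≠ 0) (k : ℕ) :
    IsResidue (fun z => 1 / (z * (z₀ ^ 2 - z ^ 2)) * (z ^ 2)⁻¹ ^ k) ((z₀ ^ 2)⁻¹ ^ (k + 1)) := by
  refine ((hasTaylor_inv_sub (pow_ne_zero 2 h)).isResidue k).congr fun z _ => ?_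
  rw [one_div, mul_inv]
  ring

/-- Residues against the recursion kernel and the Bergman kernel. -/
theorem isResidue_kernel_bergman {z₀ a : ℂ} (h : z₀ ≠ 0) (ha : a ≠ 0) (k : ℕ) :
    IsResidue (fun z => 1 / (z * (z₀ ^ 2 - z ^ 2)) *
        ((1 / (z - a) ^ 2 + 1 / (-z - a) ^ 2) * (z ^ 2)⁻¹ ^ k))
      (2 * ∑ b ∈ Finset.range (k + 1),
        (z₀ ^ 2)⁻¹ ^ (k + 1 - b) * (2 * (b : ℂ) + 1) * (a ^ 2)⁻¹ ^ (b + 1)) := by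
  have h1 := (((hasTaylor_bergman (pow_ne_zero 2 ha)).mul
    (hasTaylor_inv_sub (pow_ne_zero 2 h))).isResidue k).const_mul 2
  rw [Finset.Nat.sum_antidiagonal_eq_sum_range_succ (fun i j =>
    (2 * (i : ℂ) + 1) * (a ^ 2)⁻¹ ^ (i + 1) * (z₀ ^ 2)⁻¹ ^ (j + 1))] at h1
  have h2 : ∀ b ∈ Finset.range (k + 1),
      (z₀ ^ 2)⁻¹ ^ (k + 1 - b) * (2 * (b : ℂ) + 1) * (a ^ 2)⁻¹ ^ (b + 1) =
      (2 * (b : ℂ) + 1) * (a ^ 2)⁻¹ ^ (b + 1) * (z₀ ^ 2)⁻¹ ^ (k - b + 1) := by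
    intro b hb
    have := Finset.mem_range.1 hb
    rw [show k + 1 - b = k - b + 1 by omega]
    ring
  rw [Finset.sum_congr rfl h2]
  have h3 : ∀ c ≠ 0, ∀ᶠ z : ℂ in 𝓝[≠] 0, z ≠ c := fun c hc =>
    mem_nhdsWithin_of_mem_nhds (isOpen_ne.mem_nhds hc.symm)
  refine h1.congr' ?_
  filter_upwards [h3 a ha, h3 (-a) (neg_ne_zero.2 ha)] with z hz hz'
  have h4 : z - a ≠ 0 := sub_ne_zero.2 hz
  have h5 : -z - a ≠ 0 := fun h => hz' (by linear_combination -h)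
  have h6 : 1 / (z - a) ^ 2 + 1 / (-z - a) ^ 2 =
      2 * ((a ^ 2 + z ^ 2) * ((a ^ 2 - z ^ 2) ^ 2)⁻¹) := by
    rw [show a ^ 2 - z ^ 2 = (z - a) * (-z - a) by ring]
    field_simp
    ring
  rw [h6, one_div, mul_inv]
  ring

theorem isResidue_kernel_analytic {z₀ : ℂ} (h : z₀ ≠ 0) {G : ℂ → ℂ} (hG : AnalyticAt ℂ G 0) :
    IsResidue (fun z => 1 / (z * (z₀ ^ 2 - z ^ 2)) * G z) ((z₀ ^ 2)⁻¹ * G 0) := by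
  have h1 : AnalyticAt ℂ (fun z => (z₀ ^ 2 - z ^ 2)⁻¹ * G z) 0 := by
    refine AnalyticAt.mul (AnalyticAt.inv (by fun_prop) ?_) hG
    simpa using h
  have h2 := isResidue_inv_mul h1
  simp only [ne_eq, OfNat.ofNat_ne_zero, not_false_eq_true, zero_pow, sub_zero] at h2
  refine h2.congr fun z _ => ?_
  rw [one_div, mul_inv]
  ring

/-! ### Residues of loop insertions -/

/-- The coefficients of the loop insertion operator at the point `z` of the curve. -/
def loopPt (z : ℂ) : ℕ → ℂ := fun k => (z ^ 2)⁻¹ ^ (k + 1)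

theorem loopPt_neg (z : ℂ) : loopPt (-z) = loopPt z := by
  funext k; simp [loopPt]

theorem isResidue_kernel_polynomial {z₀ : ℂ} (h : z₀ ≠ 0) (P : Polynomial ℂ) :
    IsResidue (fun z => 1 / (z * (z₀ ^ 2 - z ^ 2)) * P.eval ((z ^ 2)⁻¹))
      ((z₀ ^ 2)⁻¹ * P.eval ((z₀ ^ 2)⁻¹)) := by
  have h1 : IsResidue _ _ := IsResidue.sum (s := P.support)
    fun k _ => (isResidue_kernel h k).const_mul (P.coeff k)
  rw [Polynomial.eval_eq_sum, Polynomial.sum, Finset.mul_sum]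
  convert! h1 using 2 with z k
  · rw [Polynomial.eval_eq_sum, Polynomial.sum, Finset.mul_sum]
    exact Finset.sum_congr rfl fun k _ => by ring
  · ring

theorem exists_polynomial_loopDer (M : Multiset (ℕ → ℂ)) (f : MvPolynomial ℕ ℂ) :
    ∃ P : Polynomial ℂ, ∀ y, constantCoeff (multiDer M (loopDer y f)) = P.eval y := by
  obtain ⟨K, hK⟩ := exists_mem_supported f
  refine ⟨∑ k ∈ Finset.range K,
    Polynomial.C (constantCoeff (multiDer M (pderiv k f))) * Polynomial.X ^ (k + 1), fun y => ?_⟩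
  rw [constDer_eq_sum _ hK, Polynomial.eval_finsetSum, map_sum, map_sum]
  refine Finset.sum_congr rfl fun k _ => ?_
  rw [map_smul, smul_eq_C_mul, map_mul, constantCoeff_C, Polynomial.eval_mul, Polynomial.eval_C,
    Polynomial.eval_pow, Polynomial.eval_X, mul_comm]

theorem exists_polynomial_loopDer_loopDer (M : Multiset (ℕ → ℂ)) (f : MvPolynomial ℕ ℂ) :
    ∃ P : Polynomial ℂ, ∀ y,
      constantCoeff (multiDer M (loopDer y (loopDer y f))) = P.eval y := by
  obtain ⟨K, hK⟩ := exists_mem_supported f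
  choose P hP using fun k => exists_polynomial_loopDer M (pderiv k f)
  refine ⟨∑ k ∈ Finset.range K, P k * Polynomial.X ^ (k + 1), fun y => ?_⟩
  rw [constDer_eq_sum _ hK, Polynomial.eval_finsetSum, map_sum, map_sum, map_sum]
  refine Finset.sum_congr rfl fun k _ => ?_
  rw [Derivation.map_smul, map_smul, smul_eq_C_mul, map_mul, constantCoeff_C, hP,
    Polynomial.eval_mul, Polynomial.eval_pow, Polynomial.eval_X, mul_comm]

/-- The resulting coefficients are those of the commutator in `constDer_loopShift`: the Bergman
kernel terms produce the shift part of the loop equation. -/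
theorem isResidue_kernel_bergman_loopDer {z₀ a : ℂ} (h : z₀ ≠ 0) (ha : a ≠ 0)
    (M : Multiset (ℕ → ℂ)) (f : MvPolynomial ℕ ℂ) :
    IsResidue (fun z => 1 / (z * (z₀ ^ 2 - z ^ 2)) *
        ((1 / (z - a) ^ 2 + 1 / (-z - a) ^ 2) *
          constantCoeff (multiDer M (loopDer ((z ^ 2)⁻¹) f))))
      (2 * constantCoeff (multiDer M (constDer (fun k => ∑ b ∈ Finset.range (k + 2),
        (z₀ ^ 2)⁻¹ ^ (k + 2 - b) * (2 * (b : ℂ) + 1) * loopPt a b) f))) := by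
  obtain ⟨K, hK⟩ := exists_mem_supported f
  have h1 : IsResidue _ _ := IsResidue.sum (s := Finset.range K) fun k _ =>
    (isResidue_kernel_bergman h ha (k + 1)).const_mul (constantCoeff (multiDer M (pderiv k f)))
  rw [constDer_eq_sum _ hK, map_sum, map_sum, Finset.mul_sum]
  convert! h1 using 2 with z k
  · rw [constDer_eq_sum _ hK, map_sum, map_sum, Finset.mul_sum, Finset.mul_sum]
    refine Finset.sum_congr rfl fun k _ => ?_
    rw [map_smul, smul_eq_C_mul, map_mul, constantCoeff_C]
    ring
  · rw [map_smul, smul_eq_C_mul, map_mul, constantCoeff_C]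
    simp only [loopPt]
    ring

/-! ### The correlators -/

/-- The Taylor coefficients of the free energy at the origin. -/
def corr (l : ℕ) (M : Multiset (ℕ → ℂ)) : ℂ := constantCoeff (multiDer M (freeEnergy l))

theorem corr_zero (M : Multiset (ℕ → ℂ)) : corr 0 M = 0 := by
  simp [corr, freeEnergy]

theorem corr_eq_zero {l : ℕ} {M : Multiset (ℕ → ℂ)} (h : ∀ g : ℕ, l + 2 ≠ 2 * g + M.card) :
    corr l M = 0 :=
  hasGenus_freeEnergy l M fun ⟨g, hg⟩ => h g (by exact_mod_cast hg)

theorem univ_map_vecCons {n : ℕ} (z : ℂ) (zs : Fin n → ℂ) :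
    (Finset.univ.val.map fun i => loopPt (Matrix.vecCons z zs i)) =
      loopPt z ::ₘ Finset.univ.val.map fun i => loopPt (zs i) := by
  rw [Fin.univ_val_map, Fin.univ_val_map, List.ofFn_succ]
  rfl

theorem univ_map_consSub {n : ℕ} (z : ℂ) (zs : Fin n → ℂ) (A : Finset (Fin n)) :
    (Finset.univ.val.map fun i => loopPt (consSub z zs A i)) =
      loopPt z ::ₘ A.val.map fun i => loopPt (zs i) := by
  rw [consSub, univ_map_vecCons]
  congr 1
  conv_rhs => rw [← Finset.map_orderEmbOfFin_univ A rfl, Finset.map_val, Multiset.map_map]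
  rfl

section Parts

variable {n : ℕ} (zs : Fin n → ℂ)

/-- The stable part of `W g (A.card + 1) (z, z_A)`. -/
def stablePart (g : ℕ) (A : Finset (Fin n)) (z : ℂ) : ℂ :=
  corr (2 * g + A.card - 1) (loopPt z ::ₘ A.val.map fun i => loopPt (zs i))

/-- The part of `W g (A.card + 1) (z, z_A)` coming from the Bergman kernel. -/
def unstablePart (g : ℕ) (A : Finset (Fin n)) (z : ℂ) : ℂ :=
  if g = 0 then ∑ i, if A = {i} then 1 / (z - zs i) ^ 2 else 0 else 0

theorem stablePart_neg (g : ℕ) (A : Finset (Fin n)) (z : ℂ) :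
    stablePart zs g A (-z) = stablePart zs g A z := by
  rw [stablePart, stablePart, loopPt_neg]

theorem W_consSub_eq {g : ℕ} {A : Finset (Fin n)} {z : ℂ}
    (h : 2 < 2 * g + (A.card + 1) → W g (A.card + 1) (consSub z zs A) = corr (2 * g + (A.card + 1) - 2)
      (Finset.univ.val.map fun i => loopPt (consSub z zs A i))) :
    W g (A.card + 1) (consSub z zs A) = stablePart zs g A z + unstablePart zs g A z := by
  by_cases h2 : 2 < 2 * g + (A.card + 1)
  · rw [h h2, univ_map_consSub, stablePart, unstablePart,
      show 2 * g + (A.card + 1) - 2 = 2 * g + A.card - 1 by omega]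
    rw [left_eq_add]
    split_ifs with hg
    · refine Finset.sum_eq_zero fun i _ => if_neg ?_
      rintro rfl
      simp at h2
      omega
    · rfl
  · obtain rfl : g = 0 := by omega
    have hc : A.card = 0 ∨ A.card = 1 := by omega
    -- Truncated subtraction sends both unstable types $(0,1)$ and $(0,2)$ to order 0, where the
    -- free energy is 0.
    rw [stablePart, show 2 * 0 + A.card - 1 = 0 by omega, corr_zero, zero_add, unstablePart,
      if_pos rfl]
    rcases hc with hc | hc
    · rw [W_zero_of_card hc, Finset.sum_eq_zero]
      intro i _
      rw [if_neg]
      rintro rfl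
      simp at hc
    · obtain ⟨j, rfl⟩ := Finset.card_eq_one.1 hc
      rw [Finset.sum_eq_single j]
      · rw [if_pos rfl]
        have h3 : ({j} : Finset (Fin n)).card + 1 = 2 := by simp
        have h4 := W_zero_two (consSub z zs {j})
        simp only [consSub] at h4 ⊢
        refine h4.trans ?_
        have h5 : ∀ i, ({j} : Finset (Fin n)).orderEmbOfFin rfl i = j := fun i =>
          Finset.mem_singleton.1 (Finset.orderEmbOfFin_mem {j} rfl i)
        exact congrArg (fun w => 1 / (z - zs w) ^ 2) (h5 ⟨0, by simp⟩)
      · intro i _ hi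
        rw [if_neg]
        simpa using hi.symm
      · simp

theorem sum_unstablePart_mul (g : ℕ) (z : ℂ) (X : ℕ → Finset (Fin n) → ℂ) :
    ∑ g₁ : Fin (g + 1), ∑ A : Finset (Fin n), unstablePart zs g₁ A z * X (g - g₁) Aᶜ =
      ∑ i, 1 / (z - zs i) ^ 2 * X g {i}ᶜ := by
  rw [Finset.sum_eq_single 0]
  · simp only [unstablePart, Fin.val_zero, if_true, Finset.sum_mul, Nat.sub_zero]
    rw [Finset.sum_comm]
    refine Finset.sum_congr rfl fun i _ => ?_
    rw [Finset.sum_eq_single {i}]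
    · rw [if_pos rfl]
    · intro A _ hA
      rw [if_neg hA, zero_mul]
    · simp
  · intro g₁ _ hg
    refine Finset.sum_eq_zero fun A _ => ?_
    rw [unstablePart, if_neg fun h : (g₁ : ℕ) = 0 => hg (Fin.ext h), zero_mul]
  · simp

theorem sum_mul_unstablePart (g : ℕ) (z : ℂ) (X : ℕ → Finset (Fin n) → ℂ) :
    ∑ g₁ : Fin (g + 1), ∑ A : Finset (Fin n), X g₁ A * unstablePart zs (g - g₁) Aᶜ z =
      ∑ i, 1 / (z - zs i) ^ 2 * X g {i}ᶜ := by
  rw [← sum_unstablePart_mul, ← Equiv.sum_comp Fin.revPerm]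
  refine Finset.sum_congr rfl fun g₁ _ => ?_
  rw [← Equiv.sum_comp (compl_involutive (α := Finset (Fin n))).toPerm]
  refine Finset.sum_congr rfl fun A _ => ?_
  have h1 := g₁.isLt
  simp only [Fin.revPerm_apply, Fin.val_rev, Function.Involutive.coe_toPerm, compl_compl]
  rw [mul_comm, show g + 1 - (g₁ + 1) = g - g₁ by omega, show g - (g - g₁) = (g₁ : ℕ) by omega]

/-- The sum over the splittings of the genus and of the points. -/
theorem sum_stablePart_mul {g m : ℕ} (hm : 2 * g + n = m + 2) (z : ℂ) :
    ∑ g₁ : Fin (g + 1), ∑ A : Finset (Fin n),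
        stablePart zs g₁ A z * stablePart zs (g - g₁) Aᶜ z =
      constantCoeff (multiDer (Finset.univ.val.map fun i => loopPt (zs i))
        (∑ x ∈ Finset.HasAntidiagonal.antidiagonal m,
          loopDer ((z ^ 2)⁻¹) (freeEnergy x.1) * loopDer ((z ^ 2)⁻¹) (freeEnergy x.2))) := by
  rw [map_sum, map_sum]
  have h1 : ∀ x : ℕ × ℕ, constantCoeff (multiDer (Finset.univ.val.map fun i => loopPt (zs i))
      (loopDer ((z ^ 2)⁻¹) (freeEnergy x.1) * loopDer ((z ^ 2)⁻¹) (freeEnergy x.2))) =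
      ∑ A : Finset (Fin n), corr x.1 (loopPt z ::ₘ A.val.map fun i => loopPt (zs i)) *
        corr x.2 (loopPt z ::ₘ (Aᶜ).val.map fun i => loopPt (zs i)) := by
    intro x
    rw [multiDer_mul, map_sum, Finset.powerset_univ]
    refine Finset.sum_congr rfl fun A _ => ?_
    rw [map_mul, corr, corr, multiDer_cons, multiDer_cons, Finset.compl_eq_univ_sdiff]
    rfl
  simp only [h1]
  rw [Finset.sum_comm, Finset.sum_comm (s := Finset.HasAntidiagonal.antidiagonal m)]
  refine Finset.sum_congr rfl fun A _ => ?_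
  have hc : A.card + Aᶜ.card = n := by simp [A.card_add_card_compl]
  -- Splittings with a factor of type $(0,1)$ vanish and are discarded first, so that no subtraction
  -- below is truncated.
  rw [← Finset.sum_filter_of_ne (p := fun g₁ : Fin (g + 1) => 0 < 2 * (g₁ : ℕ) + A.card ∧
    0 < 2 * (g - g₁) + Aᶜ.card)]
  · refine Finset.sum_of_injOn
      (fun g₁ : Fin (g + 1) => (2 * (g₁ : ℕ) + A.card - 1, 2 * (g - g₁) + Aᶜ.card - 1)) ?_ ?_ ?_ ?_
    · intro a ha b hb hab
      simp only [Finset.coe_filter, Finset.mem_univ, true_and, Set.mem_ofPred_eq] at ha hb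
      simp only [Prod.mk.injEq] at hab
      ext
      omega
    · intro a ha
      simp only [Finset.coe_filter, Finset.mem_univ, true_and, Set.mem_ofPred_eq] at ha
      have := a.isLt
      simp only [Finset.mem_coe, Finset.HasAntidiagonal.mem_antidiagonal]
      omega
    · rintro ⟨l, l'⟩ hl hl'
      have hl := Finset.HasAntidiagonal.mem_antidiagonal.1 hl
      simp only at hl
      by_cases h2 : corr l (loopPt z ::ₘ A.val.map fun i => loopPt (zs i)) = 0
      · rw [h2, zero_mul]
      by_cases h3 : corr l' (loopPt z ::ₘ (Aᶜ).val.map fun i => loopPt (zs i)) = 0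
      · rw [h3, mul_zero]
      -- Nonzero correlators have genera `k` and `k'`, which add up to `g`, so the pair of orders
      -- does come from a splitting.
      exfalso
      obtain ⟨k, hk⟩ : ∃ k : ℕ, l + 2 = 2 * k + (A.card + 1) := by
        by_contra hc
        push Not at hc
        exact h2 (corr_eq_zero fun k => by simpa using hc k)
      obtain ⟨k', hk'⟩ : ∃ k : ℕ, l' + 2 = 2 * k + (Aᶜ.card + 1) := by
        by_contra hc
        push Not at hc
        exact h3 (corr_eq_zero fun k => by simpa using hc k)
      have hkg : k < g + 1 := by omega
      refine hl' ⟨⟨k, hkg⟩, ?_, ?_⟩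
      · simp only [Finset.coe_filter, Finset.mem_univ, true_and, Set.mem_ofPred_eq]
        omega
      · simp only [Prod.mk.injEq]
        omega
    · intro a _
      rfl
  · intro g₁ _ hne
    by_contra hcon
    apply hne
    rw [not_and_or] at hcon
    rcases hcon with h | h
    · rw [stablePart, show 2 * (g₁ : ℕ) + A.card - 1 = 0 by omega, corr_zero, zero_mul]
    · rw [stablePart, stablePart, show 2 * (g - (g₁ : ℕ)) + Aᶜ.card - 1 = 0 by omega, corr_zero,
        mul_zero]

/-- Only $\mathcal W_{0,3}$ and $\mathcal W_{1,1}$ arise: $X_0^2$ encodes the product of two Bergman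
kernels at $z=0$, and $y^2/8$ encodes $\mathcal W_{0,2}(z,-z)$. -/
theorem constantCoeff_multiDer_loopPotential {g : ℕ} (h : 2 * g + n = 2) (y : ℂ) :
    constantCoeff (multiDer (Finset.univ.val.map fun i => loopPt (zs i)) (loopPotential y)) =
      (if g = 1 then y ^ 2 / 8 else 0) +
        y / 2 * ∑ i, 1 / (0 - zs i) ^ 2 * unstablePart zs g {i}ᶜ 0 := by
  have hg : g = 0 ∨ g = 1 := by omega
  rcases hg with rfl | rfl
  · obtain rfl : n = 2 := by omega
    have h1 : ({0}ᶜ : Finset (Fin 2)) = {1} := by decide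
    have h2 : ({1}ᶜ : Finset (Fin 2)) = {0} := by decide
    simp only [unstablePart, Fin.univ_val_map, List.ofFn_succ, List.ofFn_zero, Fin.sum_univ_two, h1, h2,
      loopPotential]
    rw [← Multiset.cons_coe, ← Multiset.cons_coe, multiDer_cons, multiDer_cons]
    simp [loopPt, smul_eq_C_mul, pow_two]
    left
    ring
  · obtain rfl : n = 0 := by omega
    simp [loopPotential, smul_eq_C_mul]

theorem sum_unstablePart_compl_eq_zero {g : ℕ} (h : 2 * g + n ≠ 2) (c : Fin n → ℂ) (z : ℂ) :
    ∑ i, c i * unstablePart zs g {i}ᶜ z = 0 := by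
  refine Finset.sum_eq_zero fun i _ => ?_
  rw [unstablePart]
  split_ifs with hg
  · rw [Finset.sum_eq_zero, mul_zero]
    intro j _
    rw [if_neg]
    intro hij
    have := congrArg Finset.card hij
    rw [Finset.card_compl, Fintype.card_fin, Finset.card_singleton, Finset.card_singleton] at this
    omega
  · rw [mul_zero]

end Parts

/-! ### The solution of the recursion -/

section Recursion

variable {g n : ℕ} {z₀ : ℂ} {zs : Fin n → ℂ}

theorem exists_polynomial_stablePart (zs : Fin n → ℂ) (g : ℕ) (A : Finset (Fin n)) :
    ∃ P : Polynomial ℂ, ∀ z, stablePart zs g A z = P.eval ((z ^ 2)⁻¹) := by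
  obtain ⟨P, hP⟩ := exists_polynomial_loopDer (A.val.map fun i => loopPt (zs i))
    (freeEnergy (2 * g + A.card - 1))
  refine ⟨P, fun z => ?_⟩
  rw [stablePart, corr, multiDer_cons, ← hP]
  rfl

/-- The integrand is sorted by how often the Bergman kernel occurs. Stable parts are even in $z$, so
the two mixed sums combine into a symmetrized kernel. -/
theorem recIntegrand_eq (hzs : ∀ i, zs i ≠ 0) {m : ℕ} (hm : 2 * g + n = m + 2)
    (ih : ∀ (g' k : ℕ) (p : Fin k → ℂ), 2 < 2 * g' + k → 2 * g' + k < 2 * g + (n + 1) →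
      (∀ i, p i ≠ 0) →
      W g' k p = corr (2 * g' + k - 2) (Finset.univ.val.map fun i => loopPt (p i)))
    {z : ℂ} (hz : z ≠ 0) :
    recIntegrand g n z₀ zs z =
      1 / (z * (z₀ ^ 2 - z ^ 2)) * (corr m (loopPt z ::ₘ loopPt z ::ₘ
          Finset.univ.val.map fun i => loopPt (zs i)) +
        (if g = 1 ∧ n = 0 then (z ^ 2)⁻¹ / 4 else 0)) +
      ∑ g₁ : Fin (g + 1), ∑ A : Finset (Fin n), 1 / (z * (z₀ ^ 2 - z ^ 2)) *
        (stablePart zs g₁ A z * stablePart zs (g - g₁) Aᶜ z) +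
      ∑ i, 1 / (z * (z₀ ^ 2 - z ^ 2)) *
        ((1 / (z - zs i) ^ 2 + 1 / (-z - zs i) ^ 2) * stablePart zs g {i}ᶜ z) +
      ∑ i, 1 / (z * (z₀ ^ 2 - z ^ 2)) *
        (1 / (z - zs i) ^ 2 * unstablePart zs g {i}ᶜ (-z)) := by
  have h1 : (if 0 < g then W (g - 1) (n + 2) (Matrix.vecCons z (Matrix.vecCons (-z) zs)) else 0) =
      corr m (loopPt z ::ₘ loopPt z ::ₘ Finset.univ.val.map fun i => loopPt (zs i)) +
        (if g = 1 ∧ n = 0 then (z ^ 2)⁻¹ / 4 else 0) := by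
    rcases g with _ | g
    · rw [if_neg (by omega), if_neg (by omega), add_zero, corr_eq_zero]
      intro k
      simp only [Multiset.card_cons, Multiset.card_map, Finset.card_val, Finset.card_univ,
        Fintype.card_fin]
      omega
    · rw [if_pos (by omega), show g + 1 - 1 = g by omega]
      by_cases hgn : 2 < 2 * g + (n + 2)
      · rw [ih g (n + 2) _ hgn (by omega), univ_map_vecCons, univ_map_vecCons, loopPt_neg,
          if_neg (by omega), add_zero, show 2 * g + (n + 2) - 2 = m by omega]
        intro i
        refine Fin.cases hz (fun i => Fin.cases (neg_ne_zero.2 hz) (fun i => hzs i) i) i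
      · obtain rfl : g = 0 := by omega
        obtain rfl : n = 0 := by omega
        obtain rfl : m = 0 := by omega
        -- The one unstable case of the first term, $\mathcal W_{0,2}(z,-z)=1/(4z^2)$.
        have hW : W 0 (0 + 2) (Matrix.vecCons z (Matrix.vecCons (-z) zs)) = (z ^ 2)⁻¹ / 4 := by
          refine (W_zero_two _).trans ?_
          change 1 / (z - -z) ^ 2 = _
          rw [show z - -z = 2 * z by ring, mul_pow, one_div, mul_inv]
          ring
        rw [corr_zero, if_pos ⟨rfl, rfl⟩, hW, zero_add]
  have hcons : ∀ (A : Finset (Fin n)) (w : ℂ), w ≠ 0 → ∀ i, consSub w zs A i ≠ 0 := by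
    intro A w hw i
    exact Fin.cases hw (fun i => hzs _) i
  have h2 : ∀ (g₁ : Fin (g + 1)) (A : Finset (Fin n)),
      W g₁ (A.card + 1) (consSub z zs A) * W (g - g₁) (Aᶜ.card + 1) (consSub (-z) zs Aᶜ) =
        stablePart zs g₁ A z * stablePart zs (g - g₁) Aᶜ z +
        unstablePart zs g₁ A z * stablePart zs (g - g₁) Aᶜ z +
        stablePart zs g₁ A z * unstablePart zs (g - g₁) Aᶜ (-z) +
        unstablePart zs g₁ A z * unstablePart zs (g - g₁) Aᶜ (-z) := by
    intro g₁ A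
    have hg₁ := g₁.isLt
    have hc : A.card + Aᶜ.card = n := by simp [A.card_add_card_compl]
    have h3 : ∀ (g' : ℕ) (B : Finset (Fin n)) (w : ℂ), w ≠ 0 → 2 * g' + B.card < 2 * g + n →
        W g' (B.card + 1) (consSub w zs B) = stablePart zs g' B w + unstablePart zs g' B w :=
      fun g' B w hw hlt => W_consSub_eq zs fun h => ih _ _ _ h (by omega) (hcons B w hw)
    -- Beside a factor of type $(0,1)$ the other factor is of the type being computed and is not
    -- covered by `ih`; only the vanishing of the first factor is used.
    have h4 : ∀ (g' : ℕ) (B : Finset (Fin n)) (w : ℂ), w ≠ 0 → 2 * g' + B.card = 0 →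
        W g' (B.card + 1) (consSub w zs B) = 0 ∧
          stablePart zs g' B w + unstablePart zs g' B w = 0 := by
      intro g' B w hw h0
      have h5 := h3 g' B w hw (by omega)
      have h6 : W g' (B.card + 1) (consSub w zs B) = 0 := by
        obtain rfl : g' = 0 := by omega
        exact W_zero_of_card (by omega) _
      exact ⟨h6, h5 ▸ h6⟩
    have h5 : W g₁ (A.card + 1) (consSub z zs A) * W (g - g₁) (Aᶜ.card + 1) (consSub (-z) zs Aᶜ) =
        (stablePart zs g₁ A z + unstablePart zs g₁ A z) *
          (stablePart zs (g - g₁) Aᶜ (-z) + unstablePart zs (g - g₁) Aᶜ (-z)) := by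
      have hz' := neg_ne_zero.2 hz
      by_cases hA : 2 * (g₁ : ℕ) + A.card = 0
      · obtain ⟨h6, h7⟩ := h4 g₁ A z hz hA
        rw [h6, h7, zero_mul, zero_mul]
      by_cases hA' : 2 * (g - g₁) + Aᶜ.card = 0
      · obtain ⟨h6, h7⟩ := h4 (g - g₁) Aᶜ (-z) hz' hA'
        rw [h6, h7, mul_zero, mul_zero]
      rw [h3 _ _ _ hz (by omega), h3 _ _ _ hz' (by omega)]
    rw [h5, stablePart_neg]
    ring
  rw [recIntegrand, h1]
  simp only [h2, Finset.sum_add_distrib]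
  rw [sum_unstablePart_mul zs g z fun g' B => stablePart zs g' B z,
    sum_mul_unstablePart zs g (-z) fun g' B => stablePart zs g' B z,
    sum_unstablePart_mul zs g z fun g' B => unstablePart zs g' B (-z)]
  simp only [← Finset.mul_sum, add_mul, Finset.sum_add_distrib]
  ring

/-- The four groups of terms have residues equal to twice the four contributions to the loop
equation; the prefactor 1/2 of the recursion removes the 2. -/
theorem isResidue_recIntegrand (hz₀ : z₀ ≠ 0) (hzs : ∀ i, zs i ≠ 0) {m : ℕ}
    (hm : 2 * g + n = m + 2)
    (ih : ∀ (g' k : ℕ) (p : Fin k → ℂ), 2 < 2 * g' + k → 2 * g' + k < 2 * g + (n + 1) →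
      (∀ i, p i ≠ 0) →
      W g' k p = corr (2 * g' + k - 2) (Finset.univ.val.map fun i => loopPt (p i))) :
    IsResidue (recIntegrand g n z₀ zs)
      (2 * corr (m + 1) (loopPt z₀ ::ₘ Finset.univ.val.map fun i => loopPt (zs i))) := by
  set M := Finset.univ.val.map fun i => loopPt (zs i) with hM
  set y₀ := (z₀ ^ 2)⁻¹ with hy₀
  have hcorr : ∀ (l : ℕ) (z : ℂ), corr l (loopPt z ::ₘ loopPt z ::ₘ M) =
      constantCoeff (multiDer M (loopDer ((z ^ 2)⁻¹) (loopDer ((z ^ 2)⁻¹) (freeEnergy l)))) := by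
    intro l z
    rw [corr, multiDer_cons, multiDer_cons]
    rfl
  obtain ⟨P, hP⟩ := exists_polynomial_loopDer_loopDer M (freeEnergy m)
  have hA := isResidue_kernel_polynomial hz₀
    (P + if g = 1 ∧ n = 0 then Polynomial.C (1 / 4) * Polynomial.X else 0)
  have hite : ∀ y, Polynomial.eval y (if g = 1 ∧ n = 0 then
      Polynomial.C (1 / 4) * Polynomial.X else 0 : Polynomial ℂ) =
      if g = 1 ∧ n = 0 then y / 4 else 0 := by
    intro y
    split_ifs
    · rw [Polynomial.eval_mul, Polynomial.eval_C, Polynomial.eval_X]; ring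
    · exact Polynomial.eval_zero
  simp only [Polynomial.eval_add, hite, ← hP, ← hcorr] at hA
  choose Q hQ using exists_polynomial_stablePart zs
  have hB : IsResidue _ _ := IsResidue.sum (s := Finset.univ) fun (g₁ : Fin (g + 1)) _ =>
    IsResidue.sum (s := Finset.univ) fun (A : Finset (Fin n)) _ =>
      isResidue_kernel_polynomial hz₀ (Q g₁ A * Q (g - g₁) Aᶜ)
  simp only [Polynomial.eval_mul, ← hQ] at hB
  have hC : IsResidue _ _ := IsResidue.sum (s := Finset.univ) fun (i : Fin n) _ =>
    isResidue_kernel_bergman_loopDer hz₀ (hzs i)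
      (({i}ᶜ : Finset (Fin n)).val.map fun i => loopPt (zs i))
      (freeEnergy m)
  have hst : ∀ (i : Fin n) (z : ℂ), stablePart zs g {i}ᶜ z =
      constantCoeff (multiDer (({i}ᶜ : Finset (Fin n)).val.map fun i => loopPt (zs i))
        (loopDer ((z ^ 2)⁻¹) (freeEnergy m))) := by
    intro i z
    have h1 : ({i}ᶜ : Finset (Fin n)).card = n - 1 := by
      rw [Finset.card_compl, Fintype.card_fin, Finset.card_singleton]
    have h2 := i.pos
    rw [stablePart, corr, multiDer_cons, h1, show 2 * g + (n - 1) - 1 = m by omega]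
    rfl
  simp only [← hst] at hC
  have hD : IsResidue _ _ := IsResidue.sum (s := Finset.univ) fun (i : Fin n) _ =>
    isResidue_kernel_analytic hz₀
      (G := fun z => 1 / (z - zs i) ^ 2 * unstablePart zs g {i}ᶜ (-z)) (by
        have h1 : ∀ j, AnalyticAt ℂ (fun z : ℂ => 1 / (z - zs j) ^ 2) 0 := fun j => by
          refine AnalyticAt.div analyticAt_const (by fun_prop) ?_
          simpa using hzs j
        have h2 : ∀ j, AnalyticAt ℂ (fun z : ℂ => 1 / (-z - zs j) ^ 2) 0 := fun j => by
          refine AnalyticAt.div analyticAt_const (by fun_prop) ?_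
          simpa using hzs j
        refine (h1 i).mul ?_
        unfold unstablePart
        split_ifs
        · refine Finset.analyticAt_fun_sum _ fun j _ => ?_
          split_ifs
          · exact h2 j
          · exact analyticAt_const
        · exact analyticAt_const)
  have htot := ((hA.add hB).add hC).add hD
  have hval : ∀ a b, IsResidue (recIntegrand g n z₀ zs) a → a = b →
    IsResidue (recIntegrand g n z₀ zs) b := fun a b h hab => hab ▸ h
  refine hval _ _ (htot.congr fun z hz => recIntegrand_eq hzs hm ih hz) ?_
  simp only [← Finset.mul_sum]
  have hcorr' : corr (m + 1) (loopPt z₀ ::ₘ M) =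
      constantCoeff (multiDer M (loopDer y₀ (freeEnergy (m + 1)))) := by
    rw [corr, multiDer_cons]
    rfl
  rw [sum_stablePart_mul zs hm, hcorr', loopDer_freeEnergy, map_add, map_add, map_add, map_add, map_smul, smul_eq_C_mul, map_mul,
    constantCoeff_C, map_add, map_add, hM, multiDer_loopShift, hcorr]
  simp only [← Finset.compl_eq_univ_sdiff, Finset.erase_eq, neg_zero]
  have hpot : constantCoeff (multiDer M (if m = 0 then loopPotential y₀ else 0)) =
      (if g = 1 ∧ n = 0 then y₀ ^ 2 / 8 else 0) +
        y₀ / 2 * ∑ i, 1 / (0 - zs i) ^ 2 * unstablePart zs g {i}ᶜ 0 := by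
    by_cases h0 : m = 0
    · rw [if_pos h0, hM, constantCoeff_multiDer_loopPotential (g := g) zs (by omega)]
      congr 1
      exact if_congr (by omega) rfl rfl
    · rw [if_neg h0, sum_unstablePart_compl_eq_zero zs (by omega), if_neg (by omega)]
      simp
  rw [← hM, hpot]
  split_ifs <;> ring

end Recursion

/-- The Eynard-Orantin differentials are the Taylor coefficients of the free energy. -/
theorem W_eq_corr (g n : ℕ) (p : Fin n → ℂ) (h : 2 < 2 * g + n) (hp : ∀ i, p i ≠ 0) :
    W g n p = corr (2 * g + n - 2) (Finset.univ.val.map fun i => loopPt (p i)) := by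
  induction hN : 2 * g + n using Nat.strong_induction_on generalizing g n with
  | _ N ih =>
    rcases n with _ | n
    -- Without points both sides are 0, as the free energy has no constant term.
    · rw [W]
      simp [corr, constantCoeff_freeEnergy]
    · obtain ⟨m, hm⟩ : ∃ m, 2 * g + n = m + 2 := ⟨2 * g + n - 2, by omega⟩
      have hres := isResidue_recIntegrand (z₀ := p 0) (zs := Fin.tail p) (hp 0)
        (fun i => hp i.succ) hm fun g' k q h1 h2 h3 => ih (2 * g' + k) (by omega) g' k q h1 h3 rfl
      have hpc : p = Matrix.vecCons (p 0) (Fin.tail p) := (Fin.cons_self_tail p).symm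
      rw [hpc, W_rec g n (by omega), hres.hasResidue.residue_eq, univ_map_vecCons,
        show N - 2 = m + 1 by omega]
      ring

theorem exists_hasResidue_recIntegrand (g n : ℕ) (z₀ : ℂ) (zs : Fin n → ℂ) (h : 1 < 2 * g + n)
    (hz₀ : z₀ ≠ 0) (hzs : ∀ i, zs i ≠ 0) : ∃ a, HasResidue (recIntegrand g n z₀ zs) 0 a := by
  obtain ⟨m, hm⟩ : ∃ m, 2 * g + n = m + 2 := ⟨2 * g + n - 2, by omega⟩
  exact ⟨_, (isResidue_recIntegrand hz₀ hzs hm fun g' k p h1 _ h3 =>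
    W_eq_corr g' k p h1 h3).hasResidue⟩

/-! ### The integrals of the correlators -/

/-- The coefficients of the integral of the loop insertion operator. -/
def primPt (x : ℂ) : ℕ → ℂ := fun k => x ^ (2 * k + 1) / (2 * (k : ℂ) + 1)

theorem two_mul_add_one_ne_zero (k : ℕ) : 2 * (k : ℂ) + 1 ≠ 0 := by
  exact_mod_cast Nat.succ_ne_zero (2 * k)

/-- Iterated derivations are multilinear in their coefficients. -/
theorem constantCoeff_multiDer_eq_sum {n K : ℕ} (c : Fin n → ℕ → ℂ) {f : MvPolynomial ℕ ℂ}
    (hf : f ∈ supported ℂ (Set.Iio K)) :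
    constantCoeff (multiDer (Finset.univ.val.map c) f) =
      ∑ κ : Fin n → Fin K, (∏ i, c i (κ i)) *
        constantCoeff (multiDer (Finset.univ.val.map fun i => Pi.single (κ i : ℕ) 1) f) := by
  induction n generalizing f with
  | zero => simp
  | succ n ih =>
    have h1 : ∀ d : Fin (n + 1) → ℕ → ℂ, multiDer (Finset.univ.val.map d) f =
        multiDer (Finset.univ.val.map fun i => d (Fin.succ i)) (constDer (d 0) f) := by
      intro d
      rw [← multiDer_cons, Fin.univ_val_map, Fin.univ_val_map, List.ofFn_succ]
      rfl
    rw [h1, constDer_eq_sum _ hf, map_sum, map_sum,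
      ← (Fin.consEquiv fun _ : Fin (n + 1) => Fin K).sum_comp, Fintype.sum_prod_type,
      ← Fin.sum_univ_eq_sum_range fun k => constantCoeff (multiDer
        (Finset.univ.val.map fun i => c (Fin.succ i)) (c 0 k • pderiv k f))]
    refine Finset.sum_congr rfl fun k _ => ?_
    rw [map_smul, smul_eq_C_mul, map_mul, constantCoeff_C, ih _ (pderiv_mem_supported _ hf),
      Finset.mul_sum]
    refine Finset.sum_congr rfl fun κ _ => ?_
    rw [h1, Fin.prod_univ_succ]
    simp only [Fin.consEquiv_apply, Fin.cons_zero, Fin.cons_succ, pderiv_eq_constDer]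
    ring

theorem loopPt_mul_eq (t : ℝ) (z : ℂ) (k : ℕ) :
    loopPt (t * z) k = (t : ℂ) ^ (-((2 * k + 2 : ℕ) : ℂ)) * loopPt z k := by
  rw [loopPt, loopPt, Complex.cpow_neg, Complex.cpow_natCast, mul_pow, mul_inv, mul_pow,
    inv_pow, ← pow_mul, mul_add, mul_one]

theorem re_neg_natCast_lt (k : ℕ) : (-((2 * k + 2 : ℕ) : ℂ)).re < -1 := by
  rw [Complex.neg_re, Complex.natCast_re]
  push_cast
  have : (0 : ℝ) ≤ k := Nat.cast_nonneg k
  linarith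

theorem integrableOn_loopPt (z : ℂ) (k : ℕ) :
    MeasureTheory.IntegrableOn (fun t : ℝ => loopPt (t * z) k) (Set.Ioi 1) := by
  have h := (integrableOn_Ioi_cpow_of_lt (re_neg_natCast_lt k) one_pos).mul_const (loopPt z k)
  exact MeasureTheory.IntegrableOn.congr_fun h (fun t _ => (loopPt_mul_eq t z k).symm)
    measurableSet_Ioi

theorem integral_loopPt (z : ℂ) (k : ℕ) :
    ∫ t in Set.Ioi (1 : ℝ), loopPt (t * z) k = loopPt z k / (2 * (k : ℂ) + 1) := by
  rw [MeasureTheory.setIntegral_congr_fun measurableSet_Ioi fun t _ => loopPt_mul_eq t z k,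
    MeasureTheory.integral_mul_const, integral_Ioi_cpow_of_lt (re_neg_natCast_lt k) one_pos,
    Complex.ofReal_one, Complex.one_cpow]
  have := two_mul_add_one_ne_zero k
  rw [show -((2 * k + 2 : ℕ) : ℂ) + 1 = -(2 * (k : ℂ) + 1) by push_cast; ring]
  field_simp

theorem neg_mul_loopPt {z : ℂ} (hz : z ≠ 0) (k : ℕ) :
    -z * (loopPt z k / (2 * (k : ℂ) + 1)) = -primPt z⁻¹ k := by
  rw [loopPt, primPt, ← inv_pow, ← pow_mul, mul_add, mul_one, pow_succ z⁻¹ (2 * k + 1), ← mul_div_assoc, ← neg_div]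
  congr 1
  have := mul_inv_cancel₀ hz
  linear_combination -z⁻¹ ^ (2 * k + 1) * this

theorem volume_restrict_rays (k : ℕ) :
    (MeasureTheory.volume : MeasureTheory.Measure (Fin k → ℝ)).restrict (rays k) =
      MeasureTheory.Measure.pi fun _ => MeasureTheory.volume.restrict (Set.Ioi 1) := by
  rw [rays, MeasureTheory.volume_pi, MeasureTheory.Measure.restrict_pi_pi]

theorem measurableSet_rays (k : ℕ) : MeasurableSet (rays k) :=
  MeasurableSet.univ_pi fun _ => measurableSet_Ioi

/-- Separation of variables: a finite sum of products of functions of one variable reduces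
convergence and Fubini to integrals of powers. -/
theorem W_rays_eq {g k : ℕ} {z : Fin k → ℂ} (h : 2 < 2 * g + k) (hz : ∀ i, z i ≠ 0)
    {K : ℕ} (hK : freeEnergy (2 * g + k - 2) ∈ supported ℂ (Set.Iio K))
    {t : Fin k → ℝ} (ht : t ∈ rays k) :
    W g k (fun i => (t i : ℂ) * z i) = ∑ κ : Fin k → Fin K, (∏ i, loopPt (t i * z i) (κ i)) *
      constantCoeff (multiDer (Finset.univ.val.map fun i => Pi.single (κ i : ℕ) 1)
        (freeEnergy (2 * g + k - 2))) := by
  rw [W_eq_corr g k _ h, corr, constantCoeff_multiDer_eq_sum _ hK]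
  intro i
  have h1 : (1 : ℝ) < t i := ht i (Set.mem_univ i)
  have h2 : (t i : ℂ) ≠ 0 := Complex.ofReal_ne_zero.2 (zero_lt_one.trans h1).ne'
  exact mul_ne_zero h2 (hz i)

theorem integrableOn_W {g k : ℕ} {z : Fin k → ℂ} (h : 2 < 2 * g + k) (hz : ∀ i, z i ≠ 0) :
    MeasureTheory.IntegrableOn (fun t : Fin k → ℝ => W g k fun i => (t i : ℂ) * z i) (rays k) := by
  obtain ⟨K, hK⟩ := exists_mem_supported (freeEnergy (2 * g + k - 2))
  refine MeasureTheory.IntegrableOn.congr_fun ?_ (fun t ht => (W_rays_eq h hz hK ht).symm)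
    (measurableSet_rays k)
  rw [MeasureTheory.IntegrableOn, volume_restrict_rays]
  refine MeasureTheory.integrable_finsetSum _ fun κ _ => MeasureTheory.Integrable.mul_const ?_ _
  exact MeasureTheory.Integrable.fintype_prod fun i => integrableOn_loopPt (z i) (κ i)

theorem Xi_eq_corr {g k : ℕ} {z : Fin k → ℂ} (h : 2 < 2 * g + k) (hz : ∀ i, z i ≠ 0) :
    Xi g k z =
    corr (2 * g + k - 2) (Finset.univ.val.map fun i => -primPt (z i)⁻¹) := by
  obtain ⟨K, hK⟩ := exists_mem_supported (freeEnergy (2 * g + k - 2))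
  rw [Xi, MeasureTheory.setIntegral_congr_fun (measurableSet_rays k)
    fun t ht => W_rays_eq h hz hK ht, volume_restrict_rays, MeasureTheory.integral_finsetSum,
    corr, constantCoeff_multiDer_eq_sum _ hK, Finset.mul_sum]
  · refine Finset.sum_congr rfl fun κ _ => ?_
    rw [MeasureTheory.integral_mul_const, ← mul_assoc]
    congr 1
    rw [MeasureTheory.integral_fintype_prod_eq_prod fun i (x : ℝ) => loopPt (x * z i) (κ i),
      ← Finset.prod_mul_distrib]
    refine Finset.prod_congr rfl fun i _ => ?_
    rw [integral_loopPt, neg_mul_loopPt (hz i), Pi.neg_apply]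
  · intro κ _
    refine MeasureTheory.Integrable.mul_const ?_ _
    exact MeasureTheory.Integrable.fintype_prod fun i => integrableOn_loopPt (z i) (κ i)

theorem constDer_neg (c : ℕ → ℂ) (f : MvPolynomial ℕ ℂ) : constDer (-c) f = -constDer c f := by
  have : constDer (-c) = -constDer c := derivation_ext fun k => by simp
  rw [this, Derivation.neg_apply]

/-- This sign, from integrating inward from infinity, cancels $(-1)^k$ in the definition of $S_n$.
-/
theorem corr_replicate_neg (l k : ℕ) (c : ℕ → ℂ) :
    corr l (Multiset.replicate k (-c)) = (-1) ^ k * corr l (Multiset.replicate k c) := by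
  have h : multiDer (Multiset.replicate k (-c)) (freeEnergy l) =
      (-1 : ℂ) ^ k • multiDer (Multiset.replicate k c) (freeEnergy l) := by
    induction k with
    | zero => simp
    | succ k ih =>
      rw [Multiset.replicate_succ, Multiset.replicate_succ, multiDer_cons', multiDer_cons', ih,
        Derivation.map_smul, constDer_neg, pow_succ, mul_smul, neg_one_smul, smul_neg]
  rw [corr, h, smul_eq_C_mul, map_mul, constantCoeff_C, corr]

/-! ### Taylor expansion along a line -/

/-- The restriction of a polynomial to the line through the origin in direction `s`. -/
def lineHom (s : ℕ → ℂ) : MvPolynomial ℕ ℂ →ₐ[ℂ] Polynomial ℂ :=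
  aeval fun k => Polynomial.C (s k) * Polynomial.X

theorem derivative_lineHom (s : ℕ → ℂ) (f : MvPolynomial ℕ ℂ) :
    Polynomial.derivative (lineHom s f) = lineHom s (constDer s f) := by
  induction f using MvPolynomial.induction_on with
  | C r => simp [lineHom]
  | add f g hf hg => simp only [map_add, hf, hg]
  | mul_X f k hf =>
    rw [map_mul, Polynomial.derivative_mul, hf, Derivation.leibniz, map_add, smul_eq_mul,
      smul_eq_mul, map_mul, map_mul, constDer_X]
    simp [lineHom]
    ring

theorem eval_zero_lineHom (s : ℕ → ℂ) (f : MvPolynomial ℕ ℂ) :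
    (lineHom s f).eval 0 = constantCoeff f := by
  induction f using MvPolynomial.induction_on with
  | C r => simp [lineHom]
  | add f g hf hg => simp only [map_add, Polynomial.eval_add, hf, hg]
  | mul_X f k hf => simp [lineHom]

theorem eval_one_lineHom (s : ℕ → ℂ) (f : MvPolynomial ℕ ℂ) :
    (lineHom s f).eval 1 = eval s f := by
  induction f using MvPolynomial.induction_on with
  | C r => simp [lineHom]
  | add f g hf hg => simp only [map_add, Polynomial.eval_add, hf, hg]
  | mul_X f k hf =>
    rw [map_mul, Polynomial.eval_mul, hf, map_mul]
    simp [lineHom]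

theorem coeff_lineHom (s : ℕ → ℂ) (f : MvPolynomial ℕ ℂ) (k : ℕ) :
    (lineHom s f).coeff k =
      1 / (k.factorial : ℂ) * constantCoeff (multiDer (Multiset.replicate k s) f) := by
  have h : Polynomial.derivative^[k] (lineHom s f) =
      lineHom s (multiDer (Multiset.replicate k s) f) := by
    induction k with
    | zero => simp
    | succ k ih =>
      rw [Function.iterate_succ_apply', ih, derivative_lineHom, Multiset.replicate_succ,
        multiDer_cons']
  have h1 := Polynomial.coeff_iterate_derivative (k := k) (lineHom s f) 0
  rw [h, Polynomial.coeff_zero_eq_eval_zero, eval_zero_lineHom, zero_add,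
    Nat.descFactorial_self, nsmul_eq_mul] at h1
  have h2 : (k.factorial : ℂ) ≠ 0 := Nat.cast_ne_zero.2 k.factorial_ne_zero
  rw [h1]
  field_simp

/-- Taylor's formula along a line; the genus condition bounds the degree by `m + 2`. -/
theorem eval_freeEnergy (s : ℕ → ℂ) (m : ℕ) :
    eval s (freeEnergy m) =
      ∑ k ∈ Finset.range (m + 3), 1 / (k.factorial : ℂ) * corr m (Multiset.replicate k s) := by
  rw [← eval_one_lineHom, Polynomial.eval_eq_sum_range' (n := m + 3)]
  · refine Finset.sum_congr rfl fun k _ => ?_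
    rw [coeff_lineHom, one_pow, mul_one, corr]
  · rw [Nat.lt_succ_iff, Polynomial.natDegree_le_iff_coeff_eq_zero]
    intro k hk
    rw [coeff_lineHom]
    have := corr_eq_zero (l := m) (M := Multiset.replicate k s) fun g => by
      rw [Multiset.card_replicate]; omega
    rw [corr] at this
    rw [this, mul_zero]

/-- The functions `S n` for `n ≥ 2` are values of the free energy. -/
theorem S_add_two (F p l : ℂ → ℂ) (n : ℕ) (u : ℂ) :
    S F p l (n + 2) u = eval (primPt (p u)⁻¹) (freeEnergy (n + 1)) := by
  simp only [S]
  -- The identity is needed at every `u`, as it is used for power series over all functions on `ℂ`.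
  -- At a zero of `p` both sides vanish, because the inverse of 0 is 0.
  by_cases hq : p u = 0
  · have h1 : primPt (p u)⁻¹ = 0 := by
      funext k
      simp [primPt, hq]
    rw [h1, Finset.sum_eq_zero]
    · have := constantCoeff_freeEnergy (n + 1)
      rw [constantCoeff_eq] at this
      rw [MvPolynomial.eval_zero, constantCoeff_eq, this]
    · rintro ⟨g, k⟩ hx
      simp only [Finset.mem_filter, Finset.mem_product, Finset.mem_Icc] at hx
      rw [Xi, Finset.prod_eq_zero (Finset.mem_univ (⟨0, hx.1.2.1⟩ : Fin k)) (by simp [hq]),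
        zero_mul, mul_zero]
  · rw [eval_freeEnergy]
    refine Finset.sum_of_injOn (fun x : ℕ × ℕ => x.2) ?_ ?_ ?_ ?_
    · rintro ⟨g, k⟩ hx ⟨g', k'⟩ hx' hkk
      simp only [Finset.coe_filter, Set.mem_ofPred_eq] at hx hx'
      simp only at hkk
      ext
      · simp only; omega
      · exact hkk
    · rintro ⟨g, k⟩ hx
      simp only [Finset.coe_filter, Set.mem_ofPred_eq, Finset.mem_product, Finset.mem_Icc] at hx
      simp only [Finset.mem_coe, Finset.mem_range]
      omega
    -- Terms missing from the sum for $S_n$ are the constant term and those of the wrong parity,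
    -- which carry no genus.
    · intro k hk hk'
      have hk := Finset.mem_range.1 hk
      rcases Nat.eq_zero_or_pos k with rfl | hk0
      · simp [corr, constantCoeff_freeEnergy]
      · rw [corr_eq_zero, mul_zero]
        intro g hg
        rw [Multiset.card_replicate] at hg
        refine hk' ⟨(g, k), ?_, rfl⟩
        simp only [Finset.coe_filter, Set.mem_ofPred_eq, Finset.mem_product, Finset.mem_Icc,
          Finset.mem_range]
        omega
    · rintro ⟨g, k⟩ hx
      simp only [Finset.mem_filter] at hx
      have hx := hx.2
      simp only
      rw [Xi_eq_corr (by omega) fun _ => hq, Multiset.map_const', Finset.card_val,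
        Finset.card_univ, Fintype.card_fin, corr_replicate_neg,
        show 2 * g + k - 2 = n + 1 by omega]
      have h2 : (-1 : ℂ) ^ k * (-1) ^ k = 1 := by rw [← mul_pow]; norm_num
      rw [div_eq_mul_one_div, mul_mul_mul_comm, h2, one_mul]

/-! ### Homogeneity and the principal specialization -/

theorem eval_primPt {w : ℕ} {f : MvPolynomial ℕ ℂ} (hf : shiftDer 1 f = (w : ℂ) • f) (x : ℂ) :
    eval (primPt x) f = eval (primPt 1) f * x ^ w := by
  -- Along the curve $x\mapsto$ `primPt x` the Euler derivation becomes $x\,d/dx$, so a polynomial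
  -- of weight `w` becomes a monomial of degree `w`.
  let Ψ : MvPolynomial ℕ ℂ →ₐ[ℂ] Polynomial ℂ :=
    aeval fun k => Polynomial.C (1 / (2 * (k : ℂ) + 1)) * Polynomial.X ^ (2 * k + 1)
  have hΨ : ∀ k, Ψ (X k) = Polynomial.C (1 / (2 * (k : ℂ) + 1)) * Polynomial.X ^ (2 * k + 1) :=
    fun k => aeval_X _ _
  have h1 : ∀ (y : ℂ) (g : MvPolynomial ℕ ℂ), (Ψ g).eval y = eval (primPt y) g := by
    intro y g
    induction g using MvPolynomial.induction_on with
    | C r => simp [Ψ]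
    | add f g hf hg => simp only [map_add, Polynomial.eval_add, hf, hg]
    | mul_X f k hf =>
      rw [map_mul, Polynomial.eval_mul, hf, map_mul, hΨ, eval_X, primPt]
      simp only [Polynomial.eval_mul, Polynomial.eval_C, Polynomial.eval_pow, Polynomial.eval_X]
      ring
  have h2 : ∀ g : MvPolynomial ℕ ℂ,
      Polynomial.X * Polynomial.derivative (Ψ g) = Ψ (shiftDer 1 g) := by
    intro g
    induction g using MvPolynomial.induction_on with
    | C r => simp [Ψ]
    | add f g hf hg => simp only [map_add, mul_add, hf, hg]
    | mul_X f k hf =>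
      have hk := two_mul_add_one_ne_zero k
      rw [map_mul, Polynomial.derivative_mul, Derivation.leibniz, map_add, smul_eq_mul,
        smul_eq_mul, map_mul, map_mul, ← hf, shiftDer_X, if_pos (by omega), Nat.add_sub_cancel,
        map_smul, hΨ, Polynomial.derivative_C_mul_X_pow, Nat.add_sub_cancel,
        Polynomial.smul_eq_C_mul, Polynomial.C_mul]
      push_cast
      simp only [Polynomial.C_add, Polynomial.C_mul, Polynomial.C_1]
      ring
  have h3 : Ψ f = Polynomial.C ((Ψ f).coeff w) * Polynomial.X ^ w := by
    have h4 := h2 f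
    rw [hf, map_smul] at h4
    ext k
    rw [Polynomial.coeff_C_mul_X_pow]
    split_ifs with hk
    · rw [hk]
    · have h5 := congrArg (Polynomial.coeff · k) h4
      simp only [Polynomial.coeff_smul, smul_eq_mul] at h5
      have h6 : (Polynomial.X * Polynomial.derivative (Ψ f)).coeff k = k * (Ψ f).coeff k := by
        rcases k with _ | k
        · simp
        · rw [Polynomial.coeff_X_mul, Polynomial.coeff_derivative]
          push_cast
          ring
      rw [h6, ← sub_eq_zero, ← sub_mul, mul_eq_zero] at h5
      refine h5.resolve_left fun h7 => hk ?_
      exact_mod_cast sub_eq_zero.1 h7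
  rw [← h1, ← h1, h3]
  simp

/-- The coefficients of the asymptotic expansion of the Airy function. -/
def airyCoeff (m : ℕ) : ℂ := eval (primPt 1) (partitionCoeff m)

theorem eval_derivation_congr {s : ℕ → ℂ}
    {D₁ D₂ : Derivation ℂ (MvPolynomial ℕ ℂ) (MvPolynomial ℕ ℂ)}
    (h : ∀ k, eval s (D₁ (X k)) = eval s (D₂ (X k))) (f : MvPolynomial ℕ ℂ) :
    eval s (D₁ f) = eval s (D₂ f) := by
  induction f using MvPolynomial.induction_on with
  | C r => simp
  | add f g hf hg => simp only [map_add, hf, hg]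
  | mul_X f k hf =>
    simp only [Derivation.leibniz, map_add, smul_eq_mul, map_mul, hf, h]

theorem primPt_one (k : ℕ) : primPt 1 k = 1 / (2 * (k : ℂ) + 1) := by
  rw [primPt, one_pow]

theorem eval_loopDer_one (f : MvPolynomial ℕ ℂ) :
    eval (primPt 1) (loopDer 1 f) = eval (primPt 1) (shiftDer 1 f) := by
  refine eval_derivation_congr (fun k => ?_) f
  have := two_mul_add_one_ne_zero k
  rw [constDer_X, shiftDer_X, if_pos (by omega), Nat.add_sub_cancel, smul_eval, eval_X, eval_C,
    primPt_one, one_pow]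
  field_simp

/-- The derivation `∑ (2 k + 1) ∂ₖ`. -/
abbrev oddDer : Derivation ℂ (MvPolynomial ℕ ℂ) (MvPolynomial ℕ ℂ) :=
  constDer fun k => 2 * (k : ℂ) + 1

theorem loopDer_one_euler (f : MvPolynomial ℕ ℂ) :
    loopDer 1 (shiftDer 1 f) = shiftDer 1 (loopDer 1 f) + oddDer f := by
  have h := constDer_shiftDer (fun k => (1 : ℂ) ^ (k + 1)) 1 f
  rw [show (fun k : ℕ => if 1 ≤ k + 1 then (2 * ((k + 1 - 1 : ℕ) : ℂ) + 1) * (1 : ℂ) ^ (k + 1 - 1 + 1)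
    else 0) = fun k : ℕ => 2 * (k : ℂ) + 1 from funext fun k => by
      rw [if_pos (by omega), Nat.add_sub_cancel, one_pow, mul_one]] at h
  exact h

/-- At $X_b=1/(2b+1)$ each of the $k+2$ summands of `loopShift 1 (X k)` equals 1, and
$k+2=\frac12(2k+1)+\frac32$. -/
theorem eval_loopShift_one (f : MvPolynomial ℕ ℂ) :
    eval (primPt 1) (loopShift 1 f) =
      1 / 2 * eval (primPt 1) (oddDer f) + 3 / 2 * eval (primPt 1) (loopDer 1 f) := by
  have h := eval_derivation_congr (s := primPt 1) (D₁ := loopShift 1)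
    (D₂ := (1 / 2 : ℂ) • oddDer + (3 / 2 : ℂ) • loopDer 1) (fun k => ?_) f
  · rw [h, Derivation.add_apply, Derivation.smul_apply, Derivation.smul_apply, map_add, smul_eval,
      smul_eval]
  · rw [loopShift_X, map_sum, Derivation.add_apply, Derivation.smul_apply, Derivation.smul_apply,
      map_add, smul_eval, smul_eval, constDer_X, constDer_X, eval_C, eval_C,
      Finset.sum_congr rfl (g := fun _ => 1)]
    · simp
      ring
    · intro b _
      have := two_mul_add_one_ne_zero b
      rw [smul_eval, eval_X, primPt_one, one_pow]
      field_simp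

/-- At this point `loopDer 1` acts as the Euler derivation, so the loop equation with $y=1$ involves
weights only. The two contributions of `oddDer`, from the second order part and from the shift,
cancel. -/
theorem airyCoeff_succ (m : ℕ) : 6 * ((m : ℂ) + 1) * airyCoeff (m + 1) =
    (3 * m + 1 / 2) * (3 * m + 5 / 2) * airyCoeff m := by
  have hE : ∀ m, eval (primPt 1) (loopDer 1 (partitionCoeff m)) = 3 * (m : ℂ) * airyCoeff m := by
    intro m
    rw [eval_loopDer_one, euler_partitionCoeff, smul_eval, airyCoeff]
  have h1 := hE (m + 1)
  rw [loopDer_partitionCoeff, map_add, map_add, smul_eval, map_mul, eval_loopShift_one, hE] at h1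
  have h2 : eval (primPt 1) (loopDer 1 (loopDer 1 (partitionCoeff m))) =
      3 * m * (3 * m * airyCoeff m) - eval (primPt 1) (oddDer (partitionCoeff m)) := by
    have h3 := loopDer_one_euler (partitionCoeff m)
    rw [eval_loopDer_one, ← hE m, eq_sub_iff_add_eq, ← map_add, ← h3, euler_partitionCoeff,
      Derivation.map_smul, smul_eval]
  have h3 : eval (primPt 1) (loopPotential 1) = 5 / 8 := by
    simp [loopPotential, smul_eval, primPt]
    norm_num
  rw [h2, h3, ← airyCoeff] at h1
  push_cast at h1
  linear_combination -2 * h1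

/-! ### The wave function -/

/-- The evaluation of polynomials at the points attached to the branch `p`. -/
def branchEval (p : ℂ → ℂ) : MvPolynomial ℕ ℂ →+* (ℂ → ℂ) :=
  RingHom.pi fun u => eval (primPt (p u)⁻¹)

theorem derivative_map {A B : Type*} [CommRing A] [CommRing B] (φ : A →+* B) (f : PowerSeries A) :
    PowerSeries.derivative B (PowerSeries.map φ f) =
      PowerSeries.map φ (PowerSeries.derivative A f) := by
  ext m
  simp [PowerSeries.coeff_derivative]

/-- Both sides solve $Y'=YG'$ with constant term 1. -/
theorem exp_subst_eq_map {A : Type*} [CommRing A] [Algebra ℚ A] (φ : MvPolynomial ℕ ℂ →+* A) :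
    (PowerSeries.exp A).subst (PowerSeries.map φ freeEnergySeries) =
      PowerSeries.map φ partitionSeries := by
  set G := PowerSeries.map φ freeEnergySeries with hG
  have hG0 : PowerSeries.constantCoeff G = 0 := by
    rw [hG, ← PowerSeries.coeff_zero_eq_constantCoeff_apply, PowerSeries.coeff_map,
      freeEnergySeries, PowerSeries.coeff_mk, freeEnergy, map_zero]
  have hs : PowerSeries.HasSubst G := PowerSeries.HasSubst.of_constantCoeff_zero' hG0
  rw [← sub_eq_zero]
  refine powerSeries_eq_zero_of_derivative (B := PowerSeries.derivative A G) ?_ ?_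
  · have hZ : PowerSeries.derivative A (PowerSeries.map φ partitionSeries) =
        PowerSeries.map φ partitionSeries * PowerSeries.derivative A G := by
      rw [derivative_map, derivative_partitionSeries, map_mul, hG, derivative_map]
    rw [map_sub, PowerSeries.derivative_subst hs, PowerSeries.derivative_exp, hZ, sub_mul]
  · have h1 : (PowerSeries.exp A).subst G = (PowerSeries.exp A - 1).subst G + 1 := by
      rw [PowerSeries.subst_sub hs, ← PowerSeries.coe_substAlgHom hs, map_one, sub_add_cancel]
    have h2 : PowerSeries.constantCoeff ((PowerSeries.exp A - 1).subst G) = 0 :=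
      PowerSeries.constantCoeff_subst_eq_zero hG0 _ (by simp)
    have h3 := constantCoeff_partitionSeries
    rw [← PowerSeries.coeff_zero_eq_constantCoeff_apply] at h3
    rw [map_sub, h1, map_add, h2, ← PowerSeries.coeff_zero_eq_constantCoeff_apply (PowerSeries.map _ _),
      PowerSeries.coeff_map, h3]
    simp

theorem coeff_expWave (F p l : ℂ → ℂ) (m : ℕ) (u : ℂ) :
    PowerSeries.coeff m (expWave (S F p l)) u =
      Complex.exp (-(1 / 2) * l u) * (airyCoeff m * (p u)⁻¹ ^ (3 * m)) := by
  have h1 : (PowerSeries.mk fun m => if m = 0 then 0 else S F p l (m + 1) :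
      PowerSeries (ℂ → ℂ)) = PowerSeries.map (branchEval p) freeEnergySeries := by
    ext m u
    rw [PowerSeries.coeff_mk, PowerSeries.coeff_map, freeEnergySeries, PowerSeries.coeff_mk]
    rcases m with _ | m
    · simp [freeEnergy]
    · rw [if_neg (by omega), S_add_two]
      rfl
  rw [expWave, h1, exp_subst_eq_map, PowerSeries.coeff_C_mul, PowerSeries.coeff_map,
    partitionSeries, PowerSeries.coeff_mk, Pi.mul_apply]
  congr 1
  change eval (primPt (p u)⁻¹) (partitionCoeff m) = _
  rw [eval_primPt (w := 3 * m), airyCoeff]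
  rw [euler_partitionCoeff]
  push_cast
  rfl

theorem S_add_two_eq (F p l : ℂ → ℂ) (n : ℕ) (u : ℂ) :
    S F p l (n + 2) u = eval (primPt 1) (freeEnergy (n + 1)) * (p u)⁻¹ ^ (3 * (n + 1)) := by
  rw [S_add_two, eval_primPt (w := 3 * (n + 1))]
  rw [euler_freeEnergy]
  push_cast
  rfl

/-! ### The quantum curve -/

theorem deriv_curveU (q : ℂ) : deriv curveU q = q := by
  have h : HasDerivAt curveU (2 * q / 2) q := by
    simpa using! (hasDerivAt_pow 2 q).div_const 2
  rw [h.deriv]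
  ring

theorem hasDerivAt_pow_of_ne_zero {q : ℂ → ℂ} {q' u : ℂ} (hq : HasDerivAt q q' u) (h0 : q u ≠ 0)
    (n : ℕ) : HasDerivAt (fun v => q v ^ n) (n * q u ^ n / q u * q') u := by
  rcases n with _ | n
  · simpa using hasDerivAt_const u (1 : ℂ)
  · convert! hq.fun_pow (n + 1) using 1
    rw [Nat.add_sub_cancel, pow_succ]
    field_simp

section Branch

variable {U : Set ℂ} {p l : ℂ → ℂ} {u : ℂ}

theorem branch_ne_zero (hlp : ∀ u ∈ U, Complex.exp (l u) = deriv curveU (p u)) (hu : u ∈ U) :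
    p u ≠ 0 := by
  rw [← deriv_curveU (p u), ← hlp u hu]
  exact Complex.exp_ne_zero _

theorem hasDerivAt_branch (hU : IsOpen U) (hp : DifferentiableOn ℂ p U)
    (hpu : ∀ u ∈ U, curveU (p u) = u) (hu : u ∈ U) :
    HasDerivAt p (p u)⁻¹ u := by
  have h1 := (hp.differentiableAt (hU.mem_nhds hu)).hasDerivAt
  have h2 : HasDerivAt (fun v => p v ^ 2 / 2) (2 * p u * deriv p u / 2) u := by
    simpa using (h1.fun_pow 2).div_const 2
  have h3 : HasDerivAt (fun v => p v ^ 2 / 2) 1 u :=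
    (hasDerivAt_id u).congr_of_eventuallyEq
      (Filter.eventuallyEq_of_mem (hU.mem_nhds hu) fun v hv => hpu v hv)
  have h4 := h2.unique h3
  have h5 : deriv p u = (p u)⁻¹ := eq_inv_of_mul_eq_one_right (by linear_combination h4)
  exact h5 ▸ h1

theorem hasDerivAt_log (hU : IsOpen U) (hl : DifferentiableOn ℂ l U)
    (hlp : ∀ u ∈ U, Complex.exp (l u) = deriv curveU (p u)) (h0 : p u ≠ 0)
    (hp' : HasDerivAt p (p u)⁻¹ u) (hu : u ∈ U) :
    HasDerivAt l ((p u)⁻¹ ^ 2) u := by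
  have h1 := (hl.differentiableAt (hU.mem_nhds hu)).hasDerivAt
  have h3 : HasDerivAt (fun v => Complex.exp (l v)) (p u)⁻¹ u :=
    hp'.congr_of_eventuallyEq (Filter.eventuallyEq_of_mem (hU.mem_nhds hu) fun v hv => by
      rw [hlp v hv, deriv_curveU])
  have h4 := h1.cexp.unique h3
  rw [hlp u hu, deriv_curveU] at h4
  have h5 : deriv l u = (p u)⁻¹ ^ 2 := by
    rw [pow_two]
    nth_rewrite 2 [← h4]
    rw [inv_mul_cancel_left₀ h0]
  exact h5 ▸ h1

theorem hasDerivAt_amplitude (h0 : p u ≠ 0) (hp' : HasDerivAt p (p u)⁻¹ u)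
    (hl' : HasDerivAt l ((p u)⁻¹ ^ 2) u) (a : ℂ) (m : ℕ) :
    HasDerivAt (fun v => Complex.exp (-(1 / 2) * l v) * (a * (p v)⁻¹ ^ (3 * m)))
      (Complex.exp (-(1 / 2) * l u) * (a * (p u)⁻¹ ^ (3 * m)) *
        ((-(1 / 2) - 3 * m) * (p u)⁻¹ ^ 2)) u := by
  have h1 := (hl'.const_mul (-(1 / 2))).cexp
  have h2 := (hasDerivAt_pow_of_ne_zero (hp'.fun_inv h0) (inv_ne_zero h0) (3 * m)).const_mul a
  convert! h1.fun_mul h2 using 1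
  push_cast
  field_simp
  ring

theorem coeff_zero_hatV (φ : ℂ → ℂ) (ψ : WaveFunction φ) (u : ℂ) :
    PowerSeries.coeff 0 (hatV φ ψ) u = deriv φ u * PowerSeries.coeff 0 ψ u := by
  rw [hatV, map_add, PowerSeries.coeff_C_mul, PowerSeries.coeff_zero_X_mul, add_zero, Pi.mul_apply]

theorem coeff_succ_hatV (φ : ℂ → ℂ) (ψ : WaveFunction φ) (m : ℕ) (u : ℂ) :
    PowerSeries.coeff (m + 1) (hatV φ ψ) u =
      deriv φ u * PowerSeries.coeff (m + 1) ψ u + deriv (PowerSeries.coeff m ψ) u := by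
  rw [hatV, map_add, PowerSeries.coeff_C_mul, PowerSeries.coeff_succ_X_mul, PowerSeries.coeff_mk,
    Pi.add_apply, Pi.mul_apply]

theorem coeff_hatA (φ : ℂ → ℂ) (ψ : WaveFunction φ) (m : ℕ) (u : ℂ) :
    PowerSeries.coeff m (hatA φ ψ) u =
      1 / 2 * PowerSeries.coeff m (hatV φ (hatV φ ψ)) u - u * PowerSeries.coeff m ψ u := by
  rw [hatA, hatU, map_sub, PowerSeries.coeff_C_mul]
  rfl

end Branch

end Airy

end

/-! ### The quantum Airy curve equation, order by order. -/

theorem theorem1p1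
    -- a holomorphic branch `p` of the parameter of the Airy curve over an open set `U`
    (U : Set ℂ) (hU : IsOpen U) (p : ℂ → ℂ) (hp : DifferentiableOn ℂ p U)
    (hpu : ∀ u ∈ U, Airy.curveU (p u) = u)
    -- a primitive `F` of `v du` on the curve
    (F : ℂ → ℂ) (hF : ∀ q, HasDerivAt F (Airy.curveV q * deriv Airy.curveU q) q)
    -- a holomorphic branch `l` of `log (du / dp)`
    (l : ℂ → ℂ) (hl : DifferentiableOn ℂ l U)
    (hlp : ∀ u ∈ U, Complex.exp (l u) = deriv Airy.curveU (p u)) :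
    -- the residues in the recursion exist
    (∀ (g n : ℕ) (z₀ : ℂ) (zs : Fin n → ℂ), 1 < 2 * g + n → z₀ ≠ 0 → (∀ i, zs i ≠ 0) →
      ∃ a, Airy.HasResidue (Airy.recIntegrand g n z₀ zs) 0 a) ∧
    -- the integrals in the definition of `S n`, `n ≥ 2`, converge absolutely
    (∀ (g k : ℕ) (z : Fin k → ℂ), 1 ≤ k → 2 < 2 * g + k → (∀ i, z i ≠ 0) →
      MeasureTheory.IntegrableOn (fun t : Fin k → ℝ => Airy.W g k fun i => (t i : ℂ) * z i)
        (Airy.rays k)) ∧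
    -- the functions `S n` are holomorphic, and so are the coefficients of `Z`
    (∀ n, DifferentiableOn ℂ (Airy.S F p l n) U) ∧
    (∀ m, DifferentiableOn ℂ (PowerSeries.coeff m (Airy.expWave (Airy.S F p l))) U) ∧
    -- `(v̂ ^ 2 / 2 - û) Z = 0` on `U`
    (∀ m, ∀ u ∈ U, PowerSeries.coeff m (Airy.hatA (Airy.S F p l 0) (Airy.expWave (Airy.S F p l))) u = 0) := by
  open Airy in
  have h0 : ∀ u ∈ U, p u ≠ 0 := fun u hu => branch_ne_zero hlp hu
  have hp' : ∀ u ∈ U, HasDerivAt p (p u)⁻¹ u := fun u hu => hasDerivAt_branch hU hp hpu hu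
  have hl' : ∀ u ∈ U, HasDerivAt l ((p u)⁻¹ ^ 2) u := fun u hu =>
    hasDerivAt_log hU hl hlp (h0 u hu) (hp' u hu) hu
  have hS0 : ∀ u ∈ U, HasDerivAt (S F p l 0) (p u) u := by
    intro u hu
    have h := HasDerivAt.comp u (hF (p u)) (hp' u hu)
    rw [deriv_curveU, curveV, mul_assoc, mul_inv_cancel₀ (h0 u hu), mul_one] at h
    exact h
  set Z := expWave (S F p l) with hZ
  have hcoeff : ∀ m, PowerSeries.coeff m Z =
      fun u => Complex.exp (-(1 / 2) * l u) * (airyCoeff m * (p u)⁻¹ ^ (3 * m)) := fun m =>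
    funext fun u => coeff_expWave F p l m u
  have hb : ∀ m, ∀ u ∈ U, HasDerivAt (PowerSeries.coeff m Z)
      (PowerSeries.coeff m Z u * ((-(1 / 2) - 3 * m) * (p u)⁻¹ ^ 2)) u := by
    intro m u hu
    rw [hcoeff]
    exact hasDerivAt_amplitude (h0 u hu) (hp' u hu) (hl' u hu) (airyCoeff m) m
  refine ⟨fun g n z₀ zs h hz₀ hzs => exists_hasResidue_recIntegrand g n z₀ zs h hz₀ hzs,
    fun g k z _ h hz => integrableOn_W h hz, fun n => ?_,
    fun m u hu => (hb m u hu).differentiableAt.differentiableWithinAt, fun m u hu => ?_⟩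
  · rcases n with _ | _ | n
    · exact fun u hu => (hS0 u hu).differentiableAt.differentiableWithinAt
    · exact hl.const_mul _
    · rw [show S F p l (n + 2) = fun u => _ from funext fun u => S_add_two_eq F p l n u]
      exact ((hp.fun_inv h0).fun_pow _).const_mul _
  · have hV0 : ∀ u ∈ U, PowerSeries.coeff 0 (hatV (S F p l 0) Z) u =
        p u * PowerSeries.coeff 0 Z u := fun u hu => by
      rw [coeff_zero_hatV, (hS0 u hu).deriv]
    have hV : ∀ m, ∀ u ∈ U, PowerSeries.coeff (m + 1) (hatV (S F p l 0) Z) u =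
        p u * PowerSeries.coeff (m + 1) Z u +
          PowerSeries.coeff m Z u * ((-(1 / 2) - 3 * m) * (p u)⁻¹ ^ 2) := fun m u hu => by
      rw [coeff_succ_hatV, (hS0 u hu).deriv, (hb m u hu).deriv]
    have hu2 : u = p u ^ 2 / 2 := (hpu u hu).symm
    have hpp := mul_inv_cancel₀ (h0 u hu)
    have hnhds := hU.mem_nhds hu
    rw [coeff_hatA]
    rcases m with _ | _ | m
    · rw [coeff_zero_hatV, (hS0 u hu).deriv, hV0 u hu]
      linear_combination -PowerSeries.coeff 0 Z u * hu2
    -- Order 1: the derivative of the factor `p` cancels the two halves coming from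
    -- $p^{-1/2}=e^{S_1}$, up to the choice of branch.
    · have hd : HasDerivAt (PowerSeries.coeff 0 (hatV (S F p l 0) Z)) _ u :=
        ((hp' u hu).fun_mul (hb 0 u hu)).congr_of_eventuallyEq
          (Filter.eventuallyEq_of_mem hnhds hV0)
      rw [coeff_succ_hatV, (hS0 u hu).deriv, hV 0 u hu, hd.deriv]
      push_cast
      linear_combination -PowerSeries.coeff 1 Z u * hu2 -
        1 / 2 * PowerSeries.coeff 0 Z u * (p u)⁻¹ * hpp
    · have hd : HasDerivAt (PowerSeries.coeff (m + 1) (hatV (S F p l 0) Z)) _ u :=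
        (((hp' u hu).fun_mul (hb (m + 1) u hu)).fun_add ((hb m u hu).fun_mul
          ((hasDerivAt_pow_of_ne_zero ((hp' u hu).fun_inv (h0 u hu)) (inv_ne_zero (h0 u hu)) 2
            ).const_mul (-(1 / 2) - 3 * (m : ℂ))))).congr_of_eventuallyEq
          (Filter.eventuallyEq_of_mem hnhds (hV m))
      rw [coeff_succ_hatV, (hS0 u hu).deriv, hV (m + 1) u hu, hd.deriv]
      have hrec := airyCoeff_succ m
      have hx : (p u)⁻¹ ^ 2 / (p u)⁻¹ * (-(p u)⁻¹ / p u ^ 2) = -(p u)⁻¹ ^ 4 := by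
        have := h0 u hu
        field_simp
      -- At order `m + 2` the first derivatives of coefficient `m + 1` and the second derivative of
      -- coefficient `m` remain. They cancel by the recursion for `airyCoeff`.
      have hB : 6 * ((m : ℂ) + 1) * PowerSeries.coeff (m + 1) Z u * (p u)⁻¹ =
          (3 * m + 1 / 2) * (3 * m + 5 / 2) * PowerSeries.coeff m Z u * (p u)⁻¹ ^ 4 := by
        rw [hcoeff, hcoeff]
        linear_combination Complex.exp (-(1 / 2) * l u) * (p u)⁻¹ ^ (3 * m + 4) * hrec
      push_cast
      linear_combination -PowerSeries.coeff (m + 2) Z u * hu2 +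
        (-(1 / 2) - 3 * ((m : ℂ) + 1)) * PowerSeries.coeff (m + 1) Z u * (p u)⁻¹ * hpp +
        (-(1 / 2) - 3 * (m : ℂ)) * PowerSeries.coeff m Z u * hx - 1 / 2 * hB
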